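/- Let $1<q<p$ be coprime integers and let $L(p,q)$ be the quotient of $S^3=\{(r_1e^{i\theta_1},r_2e^{i\theta_2}) : r_1^2+r_2^2=1\}$ by the cyclic group generated by $(\theta_1,\theta_2)\mapsto(\theta_1+\tfrac{2\pi q}{p},\theta_2+\tfrac{2\pi}{p})$, with the contact form induced by $r_1^2d\theta_1+r_2^2d\theta_2$. Put $k=\gcd(q-1,p)$. The Lagrangian projection $L(p,q)\to S^2$, whose fibres are the Reeb orbits, sends a point to the point of $S^2$ with azimuth $\phi=\frac pk(\theta_1-\theta_2)$ and latitude determined by $r_1$. Let $0<h<p$ with $\gcd(h,p)=1$, and let $v$ be the integer with $0<v<p$ and $h+vq\equiv 0 \pmod p$. In the coordinates $x=\frac{p\theta_1}{2\pi}$, $y=\frac{p\theta_2}{2\pi}$ on the universal cover of the Heegaard torus of $L(p,q)$, whose deck group is generated by $(p,0)$ and $(q,1)$, consider the periodic lift (invariant under translation by $(h,-v)$) of the rectilinear diagram of $K(p,q,h)$ that runs through centres of unit boxes, $h$ boxes to the right (from Box $0$ to Box $h$) and then $v$ boxes down (back to Box $0$). A *special front* for $K(p,q,h)$ is a curve obtained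 as follows. Put a basepoint in each box that the diagram passes through, slide each basepoint from the centre of its box along the direction $(1,1)$ inside the box, periodically, so that the $h+v$ segments joining successive basepoints have negative slopes which strictly decrease as one moves along the curve from Box $0$; then, in disjoint neighbourhoods of the basepoints (each reaching less than half way along the adjacent segments), replace the polygon by connecting curves, each contained in its box, so that the result is a smooth regular curve moving to the right with negative slope, invariant under the translation, whose slope on each connecting curve changes strictly monotonically between the slopes of the adjacent segments. Let $K_0\subset L(p,q)$ be the Legendrian knot with this front, its coordinate $r_1\in(0,1)$ being determined by $\frac{d\theta_2}{d\theta_1}=\frac{-r_1^2}{1-r_1^2}$, and let $\Gamma\subset S^2$ be the Lagrangian projection of $K_0$. The crossings of $\Gamma$ are the points of $S^2$ through which the projected closed curve passes more than once. Then, for every special front, the crossings of $\Gamma$ are in one-to-one correspondence with the disjoint union $$\{x\in\mathbb Z_{>0} : x<h,\ k\mid x\}\ \sqcup\ \{y\in\mathbb Z_{>0} : y\le v,\ k\mid y\},$$ and the number of connected components of $S^2\setminus\Gamma$ is two more than the number of crossings of $\Gamma$. -/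

import Mathlib

open Set

noncomputable section

/-! ### The three-sphere, the lens space `L(p,q)` and its Lagrangian projection -/

/-- The unit sphere in `ℂ²`. A point is `(r₁ e^{iθ₁}, r₂ e^{iθ₂})` with `r₁² + r₂² = 1`. -/
def S3 : Type := {z : ℂ × ℂ // ‖z.1‖ ^ 2 + ‖z.2‖ ^ 2 = 1}

/-- The two-sphere. -/
abbrev S2 : Type := Metric.sphere (0 : EuclideanSpace ℝ (Fin 3)) 1

lemma norm_exp_real_mul_I (a : ℝ) : ‖Complex.exp (a * Complex.I)‖ = 1 :=
  Complex.norm_exp_ofReal_mul_I a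

/-- The rotation `(θ₁, θ₂) ↦ (θ₁ + a, θ₂ + b)` of the three-sphere. -/
def rotMap (a b : ℝ) (z : S3) : S3 :=
  ⟨(Complex.exp (a * Complex.I) * z.1.1, Complex.exp (b * Complex.I) * z.1.2), by
    simpa [norm_mul, norm_exp_real_mul_I] using z.2⟩

lemma rotMap_rotMap (a b c d : ℝ) (z : S3) :
    rotMap a b (rotMap c d z) = rotMap (a + c) (b + d) z := by
  apply Subtype.ext
  simp only [rotMap, Complex.ofReal_add, add_mul, Complex.exp_add]
  ext <;> simp [mul_assoc]

lemma rotMap_zero (z : S3) : rotMap 0 0 z = z := by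
  apply Subtype.ext
  simp [rotMap]

/-- The rotation as a permutation of the three-sphere. -/
def rot (a b : ℝ) : Equiv.Perm S3 where
  toFun := rotMap a b
  invFun := rotMap (-a) (-b)
  left_inv z := by rw [rotMap_rotMap]; simp [rotMap_zero]
  right_inv z := by rw [rotMap_rotMap]; simp [rotMap_zero]

/-- The Reeb flow of the contact form `r₁² dθ₁ + r₂² dθ₂` at time `t`. -/
def reebFlow (t : ℝ) : Equiv.Perm S3 := rot t t

/-- The map `F_{p,q}`. -/
def deckMap (p q : ℕ) : Equiv.Perm S3 := rot (2 * Real.pi * q / p) (2 * Real.pi / p)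

/-- The lens space `L(p,q)`: the quotient of the three-sphere by the cyclic group generated by
`F_{p,q}`. -/
def LensSpace (p q : ℕ) : Type :=
  MulAction.orbitRel.Quotient (Subgroup.zpowers (deckMap p q)) S3

/-- The universal covering `S³ → L(p,q)`. -/
def toLens (p q : ℕ) (z : S3) : LensSpace p q :=
  Quotient.mk (MulAction.orbitRel (Subgroup.zpowers (deckMap p q)) S3) z

lemma deckMap_zpow (p q : ℕ) (n : ℤ) :
    deckMap p q ^ n = rot (n * (2 * Real.pi * q / p)) (n * (2 * Real.pi / p)) := by
  have hnat : ∀ n : ℕ, deckMap p q ^ n =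
      rot (n * (2 * Real.pi * q / p)) (n * (2 * Real.pi / p)) := by
    intro n
    induction n with
    | zero => ext1 z; simp [rot, rotMap_zero]
    | succ n ih =>
      ext1 z
      rw [pow_succ', ih]
      show rotMap _ _ (rotMap _ _ z) = rotMap _ _ z
      rw [rotMap_rotMap]
      push_cast
      congr 1 <;> ring
  cases n with
  | ofNat n => simpa using hnat n
  | negSucc n =>
    rw [zpow_negSucc, hnat]
    ext1 z
    show rotMap _ _ z = rotMap _ _ z
    push_cast
    congr 1 <;> ring

lemma toLens_eq_iff (p q : ℕ) (z w : S3) :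
    toLens p q z = toLens p q w ↔
      ∃ n : ℤ, rotMap (n * (2 * Real.pi * q / p)) (n * (2 * Real.pi / p)) w = z := by
  refine (Quotient.eq (r := MulAction.orbitRel (Subgroup.zpowers (deckMap p q)) S3)).trans ?_
  show z ∈ MulAction.orbit _ w ↔ _
  constructor
  · rintro ⟨⟨g, n, rfl⟩, hg⟩
    refine ⟨n, ?_⟩
    rw [← hg]
    show _ = (deckMap p q ^ n) w
    rw [deckMap_zpow]
    rfl
  · rintro ⟨n, rfl⟩
    refine ⟨⟨deckMap p q ^ n, n, rfl⟩, ?_⟩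
    show (deckMap p q ^ n) w = _
    rw [deckMap_zpow]
    rfl

/-- The unit complex number `e^{i(θ₁ - θ₂)}` (zero on the two core circles `r₁ = 0`, `r₂ = 0`). -/
def phase (z : S3) : ℂ :=
  z.1.1 * (starRingEnd ℂ) z.1.2 / ((‖z.1.1‖ * ‖z.1.2‖ : ℝ) : ℂ)

/-- The coordinate `2 r₁ r₂ e^{iφ}`, where `φ = m (θ₁ - θ₂)`. -/
def horizontalPart (m : ℕ) (z : S3) : ℂ :=
  ((2 * ‖z.1.1‖ * ‖z.1.2‖ : ℝ) : ℂ) * phase z ^ m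

lemma norm_horizontalPart (m : ℕ) (z : S3) :
    ‖horizontalPart m z‖ = 2 * ‖z.1.1‖ * ‖z.1.2‖ := by
  unfold horizontalPart phase
  by_cases h1 : z.1.1 = 0
  · simp [h1]
  by_cases h2 : z.1.2 = 0
  · simp [h2]
  have h1' : ‖z.1.1‖ ≠ 0 := norm_ne_zero_iff.2 h1
  have h2' : ‖z.1.2‖ ≠ 0 := norm_ne_zero_iff.2 h2
  rw [norm_mul, norm_pow, norm_div, norm_mul, RCLike.norm_conj, Complex.norm_real,
    Complex.norm_real, Real.norm_of_nonneg (by positivity), Real.norm_of_nonneg (by positivity),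
    div_self (by positivity), one_pow, mul_one]

/-- The map from the three-sphere to the two-sphere with azimuth `φ = m (θ₁ - θ₂)` and height
`r₂² - r₁²` (a decreasing function of `r₁`). -/
def sphereProj (m : ℕ) (z : S3) : S2 :=
  ⟨!₂[(horizontalPart m z).re, (horizontalPart m z).im, ‖z.1.2‖ ^ 2 - ‖z.1.1‖ ^ 2], by
    rw [mem_sphere_zero_iff_norm, EuclideanSpace.norm_eq, Real.sqrt_eq_one]
    have h := norm_horizontalPart m z
    have h2 : (horizontalPart m z).re ^ 2 + (horizontalPart m z).im ^ 2
        = (2 * ‖z.1.1‖ * ‖z.1.2‖) ^ 2 := by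
      rw [← h, Complex.sq_norm, Complex.normSq_apply]; ring
    have h3 := z.2
    simp only [Fin.sum_univ_three, Real.norm_eq_abs, sq_abs]
    simp only [Matrix.cons_val_zero, Matrix.cons_val_one, Matrix.cons_val]
    rw [h2]
    have : (‖z.1.1‖ ^ 2 + ‖z.1.2‖ ^ 2) ^ 2 = 1 := by rw [h3]; norm_num
    linarith [this, sq_nonneg (‖z.1.1‖)]⟩

lemma sphereProj_eq_iff (m : ℕ) (z w : S3) :
    sphereProj m z = sphereProj m w ↔
      horizontalPart m z = horizontalPart m w ∧ ‖z.1.1‖ = ‖w.1.1‖ ∧ ‖z.1.2‖ = ‖w.1.2‖ := by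
  have hz := z.2
  have hw := w.2
  constructor
  · intro h
    have h' := congrArg (fun s : S2 => (s : EuclideanSpace ℝ (Fin 3))) h
    have h0 := congrArg (fun s : EuclideanSpace ℝ (Fin 3) => s 0) h'
    have h1 := congrArg (fun s : EuclideanSpace ℝ (Fin 3) => s 1) h'
    have h2 := congrArg (fun s : EuclideanSpace ℝ (Fin 3) => s 2) h'
    simp [sphereProj] at h0 h1 h2
    refine ⟨Complex.ext h0 h1, ?_, ?_⟩
    · rw [← sq_eq_sq₀ (norm_nonneg _) (norm_nonneg _)]; linarith
    · rw [← sq_eq_sq₀ (norm_nonneg _) (norm_nonneg _)]; linarith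
  · rintro ⟨h0, h1, h2⟩
    apply Subtype.ext
    simp only [sphereProj, h0, h1, h2]

lemma phase_rotMap (a b : ℝ) (z : S3) :
    phase (rotMap a b z) = Complex.exp (((a - b : ℝ) : ℂ) * Complex.I) * phase z := by
  unfold phase rotMap
  simp only [norm_mul, norm_exp_real_mul_I, one_mul, map_mul, ← Complex.exp_conj,
    Complex.conj_ofReal, Complex.conj_I]
  have : Complex.exp (((a - b : ℝ) : ℂ) * Complex.I)
      = Complex.exp (a * Complex.I) * Complex.exp (b * -Complex.I) := by
    rw [← Complex.exp_add]; congr 1; push_cast; ring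
  rw [this]
  ring

lemma norm_fst_rotMap (a b : ℝ) (z : S3) : ‖(rotMap a b z).1.1‖ = ‖z.1.1‖ := by
  simp [rotMap]

lemma norm_snd_rotMap (a b : ℝ) (z : S3) : ‖(rotMap a b z).1.2‖ = ‖z.1.2‖ := by
  simp [rotMap]

lemma sphereProj_rotMap (m : ℕ) (a b : ℝ) (z : S3) (j : ℤ)
    (h : m * (a - b) = j * (2 * Real.pi)) : sphereProj m (rotMap a b z) = sphereProj m z := by
  rw [sphereProj_eq_iff]
  refine ⟨?_, norm_fst_rotMap a b z, norm_snd_rotMap a b z⟩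
  unfold horizontalPart
  rw [phase_rotMap, norm_fst_rotMap, norm_snd_rotMap, mul_pow, ← Complex.exp_nat_mul]
  have : (m : ℂ) * (((a - b : ℝ) : ℂ) * Complex.I) = j * (2 * Real.pi * Complex.I) := by
    have := congrArg (fun r : ℝ => (r : ℂ) * Complex.I) h
    push_cast at this ⊢
    linear_combination this
  rw [this, Complex.exp_int_mul_two_pi_mul_I, one_mul]

lemma deck_angle (p q : ℕ) (hp : 0 < p) (hq : 1 < q) (n : ℤ) :
    ((p / Nat.gcd (q - 1) p : ℕ) : ℝ) * (n * (2 * Real.pi * q / p) - n * (2 * Real.pi / p)) =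
      ((n * ((q - 1) / Nat.gcd (q - 1) p : ℕ) : ℤ) : ℝ) * (2 * Real.pi) := by
  have hk : 0 < Nat.gcd (q - 1) p := Nat.gcd_pos_of_pos_right _ hp
  obtain ⟨a, ha⟩ := Nat.gcd_dvd_left (q - 1) p
  obtain ⟨b, hb⟩ := Nat.gcd_dvd_right (q - 1) p
  generalize Nat.gcd (q - 1) p = k at *
  have hq' : (q : ℝ) = k * a + 1 := by
    have : q = k * a + 1 := by omega
    exact_mod_cast this
  have hb' : (p : ℝ) = k * b := by exact_mod_cast hb
  rw [ha, hb, Nat.mul_div_cancel_left _ hk, Nat.mul_div_cancel_left _ hk]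
  have hp' : ((k * b : ℕ) : ℝ) ≠ 0 := by rw [← hb]; positivity
  push_cast at hp' ⊢
  rw [hq']
  have := left_ne_zero_of_mul hp'
  have := right_ne_zero_of_mul hp'
  field_simp
  ring

/-- The Lagrangian projection `L(p,q) → S²`. Its azimuth is `φ = (p/k) (θ₁ - θ₂)` with
`k = gcd(q - 1, p)`, and its latitude is given by `r₁`. By `lagProj_eq_iff` its fibres are exactly
the Reeb orbits in `L(p,q)`. -/
def lagProj (p q : ℕ) (hp : 0 < p) (hq : 1 < q) : LensSpace p q → S2 :=
  Quotient.lift (sphereProj (p / Nat.gcd (q - 1) p)) (by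
    intro z w hzw
    obtain ⟨n, rfl⟩ := (toLens_eq_iff p q z w).1 (Quotient.sound hzw)
    exact sphereProj_rotMap _ _ _ _ _ (deck_angle p q hp hq n))

lemma exists_exp_mul_eq (x y : ℂ) (h : ‖x‖ = ‖y‖) :
    ∃ a : ℝ, Complex.exp (a * Complex.I) * y = x := by
  by_cases hy : y = 0
  · refine ⟨0, ?_⟩
    subst hy
    rw [norm_zero, norm_eq_zero] at h
    simp [h]
  · have hn : ‖x / y‖ = 1 := by
      rw [norm_div, h, div_self (norm_ne_zero_iff.2 hy)]
    obtain ⟨a, ha⟩ := (Complex.norm_eq_one_iff _).1 hn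
    exact ⟨a, by rw [ha, div_mul_cancel₀ _ hy]⟩

/-- Two points of `L(p,q)` have the same Lagrangian projection if and only if they lie on the same
orbit of the Reeb flow. -/
lemma lagProj_eq_iff (p q : ℕ) (hp : 0 < p) (hq : 1 < q) (z w : S3) :
    lagProj p q hp hq (toLens p q z) = lagProj p q hp hq (toLens p q w) ↔
      ∃ t : ℝ, toLens p q z = toLens p q (reebFlow t w) := by
  constructor
  · intro h
    obtain ⟨h0, h1, h2⟩ := (sphereProj_eq_iff _ z w).1 h
    obtain ⟨a, ha⟩ := exists_exp_mul_eq _ _ h1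
    obtain ⟨b, hb⟩ := exists_exp_mul_eq _ _ h2
    by_cases hw1 : w.1.1 = 0
    · refine ⟨b, congrArg _ (Subtype.ext (Prod.ext ?_ hb.symm))⟩
      show z.1.1 = Complex.exp (b * Complex.I) * w.1.1
      rw [← ha, hw1, mul_zero, mul_zero]
    by_cases hw2 : w.1.2 = 0
    · refine ⟨a, congrArg _ (Subtype.ext (Prod.ext ha.symm ?_))⟩
      show z.1.2 = Complex.exp (a * Complex.I) * w.1.2
      rw [← hb, hw2, mul_zero, mul_zero]
    have hz : z = rotMap a b w := Subtype.ext (Prod.ext ha.symm hb.symm)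
    have hw1' : ‖w.1.1‖ ≠ 0 := norm_ne_zero_iff.2 hw1
    have hw2' : ‖w.1.2‖ ≠ 0 := norm_ne_zero_iff.2 hw2
    have hph : phase w ≠ 0 := by
      unfold phase
      refine div_ne_zero (mul_ne_zero hw1 ?_) ?_
      · simpa using hw2
      · exact_mod_cast mul_ne_zero hw1' hw2'
    obtain ⟨c, hc⟩ := Nat.gcd_dvd_left (q - 1) p
    obtain ⟨m, hm⟩ := Nat.gcd_dvd_right (q - 1) p
    have hk : 0 < Nat.gcd (q - 1) p := Nat.gcd_pos_of_pos_right _ hp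
    have hmk : p / Nat.gcd (q - 1) p = m := Nat.div_eq_of_eq_mul_right hk hm
    have hcop : Nat.Coprime c m := by
      have := Nat.coprime_div_gcd_div_gcd (m := q - 1) (n := p) hk
      rwa [hmk, Nat.div_eq_of_eq_mul_right hk hc] at this
    have hm0 : 0 < m := by
      rcases Nat.eq_zero_or_pos m with h | h
      · rw [h, mul_zero] at hm; omega
      · exact h
    rw [hmk, hz] at h0
    unfold horizontalPart at h0
    rw [norm_fst_rotMap, norm_snd_rotMap, phase_rotMap, mul_pow, ← Complex.exp_nat_mul] at h0
    have hpre : ((2 * ‖w.1.1‖ * ‖w.1.2‖ : ℝ) : ℂ) ≠ 0 := by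
      exact_mod_cast mul_ne_zero (mul_ne_zero two_ne_zero hw1') hw2'
    have h3 := mul_right_cancel₀ (pow_ne_zero m hph)
      ((mul_left_cancel₀ hpre h0).trans (one_mul _).symm)
    obtain ⟨j, hj⟩ := Complex.exp_eq_one_iff.1 h3
    have hj' : (m : ℝ) * (a - b) = j * (2 * Real.pi) := by
      have := congrArg Complex.im hj
      simpa using this
    have hbez : (c : ℤ) * Nat.gcdA c m + m * Nat.gcdB c m = 1 := by
      have := Nat.gcd_eq_gcd_ab c m
      rw [hcop] at this
      exact_mod_cast this.symm
    generalize Nat.gcdA c m = A at hbez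
    generalize Nat.gcdB c m = B at hbez
    generalize Nat.gcd (q - 1) p = k at *
    have hbez' : (c : ℝ) * A + m * B = 1 := by exact_mod_cast hbez
    have hq' : (q : ℝ) = k * c + 1 := by
      have : q = k * c + 1 := by omega
      exact_mod_cast this
    have hp' : (p : ℝ) = k * m := by exact_mod_cast hm
    have hm' : (m : ℝ) ≠ 0 := by positivity
    have hk' : (k : ℝ) ≠ 0 := by positivity
    refine ⟨b - (j * A : ℤ) * (2 * Real.pi / p), (toLens_eq_iff _ _ _ _).2 ⟨j * A, ?_⟩⟩
    show rotMap _ _ (rotMap _ _ w) = z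
    rw [rotMap_rotMap, hz]
    have e1 : ((j * A : ℤ) : ℝ) * (2 * Real.pi * q / p) + (b - (j * A : ℤ) * (2 * Real.pi / p))
        = a + (-(j * B) : ℤ) * (2 * Real.pi) := by
      have ha' : a = b + j * (2 * Real.pi) / m := by field_simp; linarith
      rw [ha', hp', hq']
      push_cast
      field_simp
      linear_combination (2 * Real.pi * k * j) * hbez'
    rw [e1, add_sub_cancel]
    apply Subtype.ext
    refine Prod.ext ?_ rfl
    show Complex.exp _ * _ = Complex.exp _ * _
    congr 1
    push_cast
    rw [add_mul, Complex.exp_add]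
    have := Complex.exp_int_mul_two_pi_mul_I (-(j * B))
    push_cast at this
    rw [show (-((j : ℂ) * B)) * (2 * Real.pi) * Complex.I
      = -((j : ℂ) * B) * (2 * Real.pi * Complex.I) by ring, this, mul_one]
  · rintro ⟨t, ht⟩
    rw [ht]
    exact sphereProj_rotMap _ _ _ _ 0 (by simp)

/-! ### Legendrian lifts of curves on the Heegaard torus -/

/-- The point of the three-sphere with coordinates `(r₁, θ₁, θ₂)`. -/
def polarPoint (r θ₁ θ₂ : ℝ) (h0 : 0 ≤ r) (h1 : r ≤ 1) : S3 :=
  ⟨((r : ℂ) * Complex.exp (θ₁ * Complex.I),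
    (Real.sqrt (1 - r ^ 2) : ℂ) * Complex.exp (θ₂ * Complex.I)), by
    have h : 0 ≤ 1 - r ^ 2 := by nlinarith
    simp only [norm_mul, norm_exp_real_mul_I, mul_one, Complex.norm_real, Real.norm_eq_abs, sq_abs]
    rw [Real.sq_sqrt h]
    ring⟩

/-- The coordinate `r₁` of a Legendrian curve whose front has slope `σ = dθ₂/dθ₁ < 0`. -/
def legendrianRadius (σ : ℝ) : ℝ := Real.sqrt (-σ / (1 - σ))

/-- `legendrianRadius σ` is the solution `r₁ ∈ (0, 1)` of `σ = -r₁² / (1 - r₁²)`. -/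
lemma legendrianRadius_spec {σ : ℝ} (hσ : σ < 0) :
    0 < legendrianRadius σ ∧ legendrianRadius σ < 1 ∧
      σ = -legendrianRadius σ ^ 2 / (1 - legendrianRadius σ ^ 2) := by
  have h1 : 0 < 1 - σ := by linarith
  have h2 : 0 < -σ / (1 - σ) := div_pos (by linarith) h1
  refine ⟨Real.sqrt_pos.2 h2, ?_, ?_⟩
  · rw [legendrianRadius, Real.sqrt_lt' one_pos, div_lt_iff₀ h1]
    linarith
  · rw [legendrianRadius, Real.sq_sqrt h2.le]
    field_simp
    ring

/-! ### Special fronts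

The universal cover of the Heegaard torus of `L(p,q)` is the plane with coordinates
`x = p θ₁ / 2π`, `y = p θ₂ / 2π`. In these coordinates the boxes of the grid diagram are the unit
squares with integral corners, the deck group is generated by `(p, 0)` and `(q, 1)`, and slopes
`dy/dx` and `dθ₂/dθ₁` agree. The box with lower left corner `(c, d)` covers the box of the grid
number one diagram which is labelled `c - q d` modulo `p`.

The knot `K(p,q,h)` has basepoints in Box `0` and Box `h`. The rectilinear curve moves `h` boxes to
the right, from Box `0` to Box `h`, and then `v` boxes down, back to Box `0`. Its lift to the plane
is invariant under translation by `(h, -v)`. -/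

/-- The column of the `i`-th box on the lifted rectilinear curve (box `i = 0` is Box `0`, box
`i = h` is Box `h`, and box `i = h + v` is Box `0` again, translated by `(h, -v)`). -/
def boxCol (h v : ℕ) (i : ℤ) : ℤ := h * (i / (h + v)) + min (i % (h + v)) h

/-- The row of the `i`-th box on the lifted rectilinear curve. -/
def boxRow (h v : ℕ) (i : ℤ) : ℤ := -(v * (i / (h + v))) - max (i % (h + v) - h) 0

/-- The `i`-th basepoint: the centre of the `i`-th box, moved by `(s i, s i)` along the
anti-diagonal of that box. -/
def basepoint (h v : ℕ) (s : ℤ → ℝ) (i : ℤ) : ℝ × ℝ :=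
  (boxCol h v i + 1 / 2 + s i, boxRow h v i + 1 / 2 + s i)

/-- The slope of the segment from the `i`-th basepoint to the next one. -/
def segmentSlope (h v : ℕ) (s : ℤ → ℝ) (i : ℤ) : ℝ :=
  ((basepoint h v s (i + 1)).2 - (basepoint h v s i).2) /
    ((basepoint h v s (i + 1)).1 - (basepoint h v s i).1)

/-- A special front, as a curve in the universal cover of the Heegaard torus. -/
structure SpecialFront (h v : ℕ) where
  /-- The amount by which each basepoint slides along the anti-diagonal of its box. -/
  slide : ℤ → ℝ
  slide_periodic : ∀ i, slide (i + (h + v)) = slide i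
  /-- Every basepoint stays in its box. -/
  abs_slide_lt : ∀ i, |slide i| < 1 / 2
  /-- All segments have negative slope. -/
  segmentSlope_neg : ∀ i, segmentSlope h v slide i < 0
  /-- Moving right from the basepoint in Box `0`, the slopes of the `h + v` segments strictly
  decrease. -/
  segmentSlope_strictAnti : ∀ i j : ℤ, 0 ≤ i → i < j → j < h + v →
    segmentSlope h v slide j < segmentSlope h v slide i
  /-- The smoothing near the `i`-th basepoint takes place at times in `[i - left i, i + right i]`. -/
  left : ℤ → ℝ
  right : ℤ → ℝ
  left_periodic : ∀ i, left (i + (h + v)) = left i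
  right_periodic : ∀ i, right (i + (h + v)) = right i
  left_mem : ∀ i, left i ∈ Ioo (0 : ℝ) (1 / 2)
  right_mem : ∀ i, right i ∈ Ioo (0 : ℝ) (1 / 2)
  /-- The two coordinates of the front. -/
  x : ℝ → ℝ
  y : ℝ → ℝ
  contDiff_x : ContDiff ℝ (⊤ : ℕ∞) x
  contDiff_y : ContDiff ℝ (⊤ : ℕ∞) y
  /-- The front closes up on the torus after one period. -/
  x_periodic : ∀ t, x (t + (h + v)) = x t + h
  y_periodic : ∀ t, y (t + (h + v)) = y t - v
  /-- The front is regular, moves to the right and has negative slope. -/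
  deriv_x_pos : ∀ t, 0 < deriv x t
  deriv_y_neg : ∀ t, deriv y t < 0
  /-- Away from the neighbourhoods of the basepoints the front runs along the segments. -/
  eq_segment : ∀ (i : ℤ) (t : ℝ), t ∈ Icc (i + right i) (i + 1 - left (i + 1)) →
    (x t, y t) = AffineMap.lineMap (basepoint h v slide i) (basepoint h v slide (i + 1)) (t - i)
  /-- The connecting curve near each basepoint stays in the box of that basepoint. -/
  mem_box : ∀ (i : ℤ) (t : ℝ), t ∈ Icc (i - left i) (i + right i) →
    x t ∈ Ioo (boxCol h v i : ℝ) (boxCol h v i + 1) ∧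
      y t ∈ Ioo (boxRow h v i : ℝ) (boxRow h v i + 1)
  /-- On each connecting curve the slope interpolates strictly monotonically between the slopes of
  the adjacent segments: it decreases, except in Box `0`, where it increases. -/
  slope_strictAntiOn : ∀ i : ℤ, ¬ ((h + v : ℤ) ∣ i) →
    StrictAntiOn (fun t => deriv y t / deriv x t) (Icc (i - left i) (i + right i))
  slope_strictMonoOn : ∀ i : ℤ, (h + v : ℤ) ∣ i →
    StrictMonoOn (fun t => deriv y t / deriv x t) (Icc (i - left i) (i + right i))

namespace SpecialFront

variable {h v : ℕ} (S : SpecialFront h v)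

/-- The slope of the front. -/
def slope (t : ℝ) : ℝ := deriv S.y t / deriv S.x t

lemma slope_neg (t : ℝ) : S.slope t < 0 := div_neg_of_neg_of_pos (S.deriv_y_neg t) (S.deriv_x_pos t)

/-- A lift to the three-sphere of the Legendrian knot with front `S`. -/
def lift (p : ℕ) (t : ℝ) : S3 :=
  polarPoint (legendrianRadius (S.slope t)) (2 * Real.pi * S.x t / p) (2 * Real.pi * S.y t / p)
    (legendrianRadius_spec (S.slope_neg t)).1.le (legendrianRadius_spec (S.slope_neg t)).2.1.le

/-- The Legendrian knot in `L(p,q)` with front `S`, as a curve of period `h + v`. -/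
def knot (p q : ℕ) (t : ℝ) : LensSpace p q := toLens p q (S.lift p t)

lemma slope_periodic (t : ℝ) : S.slope (t + (h + v)) = S.slope t := by
  have hx : deriv S.x (t + (h + v)) = deriv S.x t := by
    rw [← deriv_comp_add_const, funext S.x_periodic, deriv_add_const]
  have hy : deriv S.y (t + (h + v)) = deriv S.y t := by
    rw [← deriv_comp_add_const, funext S.y_periodic, deriv_sub_const]
  rw [slope, slope, hx, hy]

lemma knot_periodic (p q : ℕ) (hp : 0 < p) (hv : p ∣ h + v * q) (t : ℝ) :
    S.knot p q (t + (h + v)) = S.knot p q t := by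
  obtain ⟨c, hc⟩ := hv
  refine (toLens_eq_iff _ _ _ _).2 ⟨-v, ?_⟩
  have hp' : (p : ℝ) ≠ 0 := by positivity
  have hc' : (h : ℝ) = p * c - v * q := by
    rw [eq_sub_iff_add_eq]; exact_mod_cast hc
  apply Subtype.ext
  simp only [lift, polarPoint, rotMap, slope_periodic, x_periodic, y_periodic]
  refine Prod.ext ?_ ?_
  · show Complex.exp _ * (_ * Complex.exp _) = _ * Complex.exp _
    rw [mul_left_comm, ← Complex.exp_add]
    congr 1
    refine Complex.exp_eq_exp_iff_exists_int.2 ⟨-c, ?_⟩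
    have : ((-v : ℤ) : ℝ) * (2 * Real.pi * q / p) + 2 * Real.pi * S.x t / p
        = 2 * Real.pi * (S.x t + h) / p + ((-c : ℤ) : ℝ) * (2 * Real.pi) := by
      rw [hc']; push_cast; field_simp; ring
    have := congrArg (fun r : ℝ => (r : ℂ) * Complex.I) this
    push_cast at this ⊢
    linear_combination this
  · show Complex.exp _ * (_ * Complex.exp _) = _ * Complex.exp _
    rw [mul_left_comm, ← Complex.exp_add]
    congr 2
    push_cast
    ring

/-- The parametrized Lagrangian projection of the knot. -/
def lagCurve (p q : ℕ) (hp : 0 < p) (hq : 1 < q) (t : ℝ) : S2 := lagProj p q hp hq (S.knot p q t)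

/-- The Lagrangian projection `Γ` of the knot. -/
def Gamma (p q : ℕ) (hp : 0 < p) (hq : 1 < q) : Set S2 := range (S.lagCurve p q hp hq)

/-- The crossings of `Γ`: the points of the sphere through which the closed curve passes more than
once in a period. -/
def crossings (p q : ℕ) (hp : 0 < p) (hq : 1 < q) : Set S2 :=
  {c | ∃ s ∈ Ico (0 : ℝ) (h + v), ∃ t ∈ Ico (0 : ℝ) (h + v), s ≠ t ∧
    S.lagCurve p q hp hq s = c ∧ S.lagCurve p q hp hq t = c}

end SpecialFront

end

/-!
The fibres of the Lagrangian projection are cut out by `r₁`, that is by the slope `σ` of the front,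
and by `x - y` modulo `k`, where `k = gcd(q - 1, p)`. Along a special front `x - y` increases, from
one box to the next it increases by one because the basepoints slide in the direction `(1, 1)`, and
over a period it increases by `h + v = M k`. So `Γ` is the curve in geographic coordinates given by
a latitude function `G` of period `M k` in `u = x - y`, wrapped `M` times around the sphere: it is
the union of the `M` sheets `G (· + j k)`. Since the slopes of the segments decrease, `G` increases
strictly on a short interval around the multiples of `M k` (the connecting curve in Box `0`) and
decreases elsewhere, with plateaus shorter than one (`SpecialFront.isSheetProfile`).

Two sheets which are both descending are at distance at least `k ≥ 1` and never meet. The ascending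
sheet passes through each of the `M - 1` others exactly once, by the intermediate value theorem and
monotonicity, so there are `M - 1` crossings (`IsSheetProfile.nonempty_doublePoints_equiv`); this is
the number of multiples of `k` strictly between `0` and `h + v`, and the reflection `y ↦ h + v - y`
splits them into the two kinds (`nonempty_fin_equiv_multiples`).

The number of sheets above a point is locally constant off `Γ` and takes the values `0, …, M`. The
points below `0` or `M` sheets form the two caps around the poles. For `0 < i < M` the `i`-th and
`(i+1)`-st highest sheets meet only at the crossing of the ascending sheet with the sheet `i`. Hence
the points below `i` sheets form the region between two graphs over an open interval, from this
crossing once around to itself (`IsSheetProfile.sheet_lt_sheet`), which is connected. This gives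
`M + 1` components (`IsSheetProfile.card_connectedComponents`), without the Jordan curve theorem.
-/

noncomputable section

/-! ### Counting components and regions between graphs -/

/-- A subspace which is partitioned into `n` nonempty connected sets, each open in the ambient
space, has `n` connected components. -/
lemma card_connectedComponents_of_partition {Y : Type*} [TopologicalSpace Y] {U : Set Y} {n : ℕ}
    (A : Fin n → Set Y) (hopen : ∀ i, IsOpen (A i)) (hconn : ∀ i, IsPreconnected (A i))
    (hne : ∀ i, (A i).Nonempty) (hdisj : ∀ i j P, P ∈ A i → P ∈ A j → i = j)
    (hcover : ∀ P, P ∈ U ↔ ∃ i, P ∈ A i) :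
    Nat.card (ConnectedComponents ↥U) = n := by
  choose f hf using fun P : U => (hcover P).1 P.2
  have hf' : ∀ (P : U) i, P.1 ∈ A i ↔ f P = i := fun P i =>
    ⟨fun h => hdisj _ _ _ (hf P) h, fun h => h ▸ hf P⟩
  have hcont : Continuous f := by
    refine continuous_discrete_rng.2 fun i => ?_
    have : f ⁻¹' {i} = Subtype.val ⁻¹' A i := by
      ext P; simp [hf']
    rw [this]
    exact (hopen i).preimage continuous_subtype_val
  have hbij : Function.Bijective hcont.connectedComponentsLift := by
    constructor
    · intro a b
      obtain ⟨P, rfl⟩ := ConnectedComponents.surjective_coe a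
      obtain ⟨Q, rfl⟩ := ConnectedComponents.surjective_coe b
      intro hPQ
      simp only [Continuous.connectedComponentsLift_apply_coe] at hPQ
      rw [ConnectedComponents.coe_eq_coe']
      have hpre : IsPreconnected ((Subtype.val : U → Y) ⁻¹' A (f Q)) := by
        refine (Topology.IsInducing.subtypeVal.isPreconnected_image).1 ?_
        rw [Subtype.image_preimage_coe, inter_eq_right.2]
        · exact hconn _
        · exact fun P hP => (hcover P).2 ⟨_, hP⟩
      exact hpre.subset_connectedComponent (x := Q) (hf Q) ((hf' P _).2 hPQ)
    · intro i
      obtain ⟨P, hP⟩ := hne i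
      refine ⟨((⟨P, (hcover P).2 ⟨i, hP⟩⟩ : U) : ConnectedComponents U), ?_⟩
      rw [Continuous.connectedComponentsLift_apply_coe]
      exact (hf' _ _).1 hP
  rw [Nat.card_eq_of_bijective _ hbij, Nat.card_fin]

/-- The region over a connected set swept out by an interval of convex combinations of two
continuous functions is connected. -/
lemma isPreconnected_between {I J : Set ℝ} (hI : IsPreconnected I) (hJ : IsPreconnected J)
    {f g : ℝ → ℝ} (hf : Continuous f) (hg : Continuous g) :
    IsPreconnected {x : ℝ × ℝ | x.1 ∈ I ∧ ∃ s ∈ J, x.2 = f x.1 + s * (g x.1 - f x.1)} := by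
  have : {x : ℝ × ℝ | x.1 ∈ I ∧ ∃ s ∈ J, x.2 = f x.1 + s * (g x.1 - f x.1)} =
      (fun y : ℝ × ℝ => (y.1, f y.1 + y.2 * (g y.1 - f y.1))) '' (I ×ˢ J) := by
    ext ⟨u, z⟩
    constructor
    · rintro ⟨hu, s, hs, hz⟩
      exact ⟨(u, s), ⟨hu, hs⟩, Prod.ext rfl hz.symm⟩
    · rintro ⟨⟨u', s⟩, ⟨hu, hs⟩, h⟩
      obtain ⟨rfl, rfl⟩ := Prod.ext_iff.1 h
      exact ⟨hu, s, hs, rfl⟩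
  rw [this]
  exact (hI.prod hJ).image _ (by fun_prop)

/-! ### Periodic functions with one ascent and one descent, and their sheets -/

/-- A continuous function `G` of period `M k`, with values in `(-π/2, π/2)`, which increases
strictly on the short interval `[-l, r]` and decreases on the rest of the period. Plateaus are
allowed in the descent, but they have length less than one. The functions `G (· + j k)` for
`j < M` are the sheets of the graph of `G` over the circle of length `k`. -/
structure IsSheetProfile (k M : ℕ) (l r : ℝ) (G : ℝ → ℝ) : Prop where
  k_pos : 0 < k
  M_pos : 0 < M
  l_mem : l ∈ Ioo (0 : ℝ) (1 / 2)
  r_mem : r ∈ Ioo (0 : ℝ) (1 / 2)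
  continuous : Continuous G
  periodic : ∀ u, G (u + M * k) = G u
  mem_Ioo : ∀ u, G u ∈ Ioo (-(Real.pi / 2)) (Real.pi / 2)
  strictMonoOn : StrictMonoOn G (Icc (-l) r)
  antitoneOn : AntitoneOn G (Icc r (M * k - l))
  lt_of_add_one_le : ∀ a b, r ≤ a → a + 1 ≤ b → b ≤ M * k - l → G b < G a

lemma cast_mul_add_le {i j : ℕ} (k : ℕ) (hij : i < j) : (i : ℝ) * k + k ≤ j * k := by
  have : ((i + 1 : ℕ) : ℝ) ≤ j := by exact_mod_cast hij
  push_cast at this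
  nlinarith [(Nat.cast_nonneg k : (0 : ℝ) ≤ k)]

namespace IsSheetProfile

variable {k M : ℕ} {l r : ℝ} {G : ℝ → ℝ} (H : IsSheetProfile k M l r G)
include H

lemma one_le_k : (1 : ℝ) ≤ k := by exact_mod_cast H.k_pos

lemma periodic_int (u : ℝ) (n : ℤ) : G (u + n * (M * k)) = G u :=
  (show Function.Periodic G (M * k) from H.periodic).int_mul n u

/-- The ascending sheet meets each of the other sheets. -/
lemma exists_eq {i : ℕ} (hi : 0 < i) (hiM : i < M) : ∃ w ∈ Ioo (-l) r, G w = G (w + i * k) := by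
  have hk := H.one_le_k
  have hl := H.l_mem
  have hr := H.r_mem
  have h1 := cast_mul_add_le k hi
  have h2 := cast_mul_add_le k hiM
  simp only [Nat.cast_zero, zero_mul, zero_add] at h1
  have hlo : G (-l) - G (-l + i * k) < 0 := by
    have e : G (-l) = G (M * k - l) := by rw [← H.periodic (-l)]; congr 1; ring
    have := H.lt_of_add_one_le (-l + i * k) (M * k - l) (by linarith [hl.2, hr.2])
      (by linarith) le_rfl
    linarith
  have hhi : 0 < G r - G (r + i * k) := by
    have := H.lt_of_add_one_le r (r + i * k) le_rfl (by linarith) (by linarith [hl.2, hr.2])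
    linarith
  have hc : ContinuousOn (fun w => G w - G (w + i * k)) (Icc (-l) r) := by
    have := H.continuous
    fun_prop
  obtain ⟨w, hw, h0⟩ := intermediate_value_Ioo (by linarith [hl.1, hr.1]) hc ⟨hlo, hhi⟩
  exact ⟨w, hw, by simpa [sub_eq_zero] using h0⟩

/-- The ascending sheet meets each of the other sheets only once. -/
lemma eq_of_eq {i : ℕ} (hi : 0 < i) (hiM : i < M) {a b : ℝ} (ha : a ∈ Icc (-l) r)
    (hb : b ∈ Icc (-l) r) (hGa : G a = G (a + i * k)) (hGb : G b = G (b + i * k)) : a = b := by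
  wlog hab : a < b generalizing a b
  · rcases (not_lt.1 hab).lt_or_eq with h | h
    · exact (this hb ha hGb hGa h).symm
    · exact h.symm
  exfalso
  have hk := H.one_le_k
  have hl := H.l_mem
  have hr := H.r_mem
  have h1 := cast_mul_add_le k hi
  have h2 := cast_mul_add_le k hiM
  simp only [Nat.cast_zero, zero_mul, zero_add] at h1
  have h3 := H.strictMonoOn ha hb hab
  have h4 := H.antitoneOn (a := a + i * k) (b := b + i * k)
    ⟨by linarith [ha.1, hl.2, hr.2], by linarith [ha.2, hl.2, hr.2]⟩
    ⟨by linarith [hb.1, hl.2, hr.2], by linarith [hb.2, hl.2, hr.2]⟩ (by linarith)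
  linarith

/-- Between its two consecutive passages through the intersection point `w` with the `i`-th sheet,
the first `i` sheets lie strictly above the other ones. -/
lemma sheet_lt_sheet {i j j' : ℕ} (hji : j < i) (hij : i ≤ j') (hjM : j' < M) {w u : ℝ}
    (hw : w ∈ Ioo (-l) r) (hGw : G w = G (w + i * k)) (hu : u ∈ Ioo w (w + k)) :
    G (u + j' * k) < G (u + j * k) := by
  have hk := H.one_le_k
  have hl := H.l_mem
  have hr := H.r_mem
  have hi0 := cast_mul_add_le k (show 0 < i by omega)
  have hjj := cast_mul_add_le k (show j < j' by omega)
  have hij' : (i : ℝ) * k ≤ j' * k := by gcongr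
  have hM := cast_mul_add_le k hjM
  have hj0 : (0 : ℝ) ≤ j * k := by positivity
  simp only [Nat.cast_zero, zero_mul, zero_add] at hi0
  obtain ⟨hl0, hl1⟩ := hl
  obtain ⟨hr0, hr1⟩ := hr
  obtain ⟨hw0, hw1⟩ := hw
  obtain ⟨hu0, hu1⟩ := hu
  rcases lt_or_ge u r with hur | hur
  · rcases Nat.eq_zero_or_pos j with rfl | hj
    · -- Here the ascending sheet has already passed the `i`-th sheet.
      have h1 := H.strictMonoOn ⟨hw0.le, hw1.le⟩ ⟨by linarith, hur.le⟩ hu0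
      have h2 := H.antitoneOn (a := w + i * k) (b := u + j' * k)
        ⟨by linarith, by linarith⟩ ⟨by linarith, by linarith⟩ (by linarith)
      simp only [Nat.cast_zero, zero_mul, add_zero]
      linarith
    · have hj1 := cast_mul_add_le k hj
      simp only [Nat.cast_zero, zero_mul, zero_add] at hj1
      exact H.lt_of_add_one_le _ _ (by linarith) (by linarith) (by linarith)
  rcases le_or_gt u (k - l) with hul | hul
  · exact H.lt_of_add_one_le _ _ (by linarith) (by linarith) (by linarith)
  rcases Nat.lt_or_ge (j' + 1) M with hj' | hj'
  · have := cast_mul_add_le k hj'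
    push_cast at this
    exact H.lt_of_add_one_le _ _ (by linarith) (by linarith) (by linarith)
  · -- The last sheet is the ascending one, which has not yet reached the other passage.
    have hMj : (M : ℝ) * k = j' * k + k := by
      have : M = j' + 1 := by omega
      rw [this]; push_cast; ring
    have e : G (u + j' * k) = G (u - k) := by
      rw [← H.periodic (u - k), hMj]; congr 1; ring
    have h1 := H.strictMonoOn (a := u - k) (b := w) ⟨by linarith, by linarith⟩
      ⟨hw0.le, hw1.le⟩ (by linarith)
    have hji' := cast_mul_add_le k hji
    have h2 := H.antitoneOn (a := u + j * k) (b := w + i * k)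
      ⟨by linarith, by linarith⟩ ⟨by linarith, by linarith⟩ (by linarith)
    linarith

/-- Distinct sheets can only meet on the ascending part of one of them. -/
lemma exists_of_eq {a b : ℝ} {m : ℤ} (hb : b = a + m * k) (hm : ¬ (M : ℤ) ∣ m)
    (hG : G a = G b) :
    ∃ i : ℕ, 0 < i ∧ i < M ∧ ∃ w ∈ Icc (-l) r, G w = G (w + i * k) ∧
      ((∃ n : ℤ, a = w + n * k) ∧ G a = G w) := by
  have hk := H.one_le_k
  have hl := H.l_mem
  have hr := H.r_mem
  have hkpos : (0 : ℝ) < k := by linarith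
  have hMpos : (0 : ℝ) < M := by exact_mod_cast H.M_pos
  -- Move both points into the period `[-l, M k - l)`.
  have hP : 0 < (M : ℝ) * k := by positivity
  have key : ∀ c : ℝ, ∃ n : ℤ, c + n * (M * k) ∈ Ico (-l) (M * k - l) := by
    intro c
    obtain ⟨n, hn, -⟩ := existsUnique_add_zsmul_mem_Ico hP c (-l)
    refine ⟨n, ?_⟩
    simpa [zsmul_eq_mul, sub_eq_add_neg, add_comm, add_left_comm] using hn
  obtain ⟨n, hn⟩ := key a
  obtain ⟨n', hn'⟩ := key b
  set a' := a + n * (M * k) with ha'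
  set b' := b + n' * (M * k) with hb'
  have hGa : G a' = G a := H.periodic_int a n
  have hGb : G b' = G b := H.periodic_int b n'
  have hd : b' = a' + ((m + (n' - n) * M : ℤ) : ℝ) * k := by
    rw [ha', hb', hb]; push_cast; ring
  have hd' : ¬ (M : ℤ) ∣ m + (n' - n) * M := fun h => hm ((Int.dvd_add_left ⟨n' - n, by ring⟩).1 h)
  generalize m + (n' - n) * M = d at hd hd'
  have hd0 : d ≠ 0 := by rintro rfl; exact hd' (dvd_zero _)
  have hdlt : |d| < M := by
    have h1 : |(d : ℝ) * k| < M * k := by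
      rw [show (d : ℝ) * k = b' - a' by rw [hd]; ring, abs_lt]
      constructor <;> linarith [hn.1, hn.2, hn'.1, hn'.2]
    rw [abs_mul, abs_of_pos hkpos] at h1
    have := lt_of_mul_lt_mul_right h1 hkpos.le
    exact_mod_cast this
  -- The two points are symmetric; the smaller one lies on the ascending part.
  have main : ∀ c e : ℝ, ∀ i : ℕ, 0 < i → e = c + i * k → c ∈ Ico (-l) (M * k - l) →
      e ∈ Ico (-l) (M * k - l) → G c = G e → c ∈ Icc (-l) r := by
    intro c e i hi he hc hee hGce
    refine ⟨hc.1, le_of_not_gt fun hcr => ?_⟩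
    have h1 := cast_mul_add_le k hi
    simp only [Nat.cast_zero, zero_mul, zero_add] at h1
    have := H.lt_of_add_one_le c e hcr.le (by linarith) hee.2.le
    linarith
  have hGab : G a' = G b' := by rw [hGa, hGb, hG]
  rcases lt_or_gt_of_ne hd0 with hneg | hpos
  · obtain ⟨i, hi⟩ := Int.eq_ofNat_of_zero_le (show 0 ≤ -d by omega)
    have hdi : d = -(i : ℤ) := by omega
    have hi0 : 0 < i := by omega
    have he : a' = b' + i * k := by rw [hd, hdi]; push_cast; ring
    refine ⟨i, hi0, by rw [hdi, abs_neg, Nat.abs_cast] at hdlt; exact_mod_cast hdlt, b',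
      main b' a' i hi0 he hn' hn hGab.symm, by rw [← he, hGab], ⟨i - n * M, ?_⟩, by
        rw [← hGab, hGa]⟩
    rw [← add_left_inj ((n : ℝ) * (M * k)), ← ha', he]; push_cast; ring
  · obtain ⟨i, hi⟩ := Int.eq_ofNat_of_zero_le hpos.le
    have hi0 : 0 < i := by omega
    have he : b' = a' + i * k := by rw [hd, hi]; push_cast; ring
    refine ⟨i, hi0, by rw [hi, Nat.abs_cast] at hdlt; exact_mod_cast hdlt, a',
      main a' b' i hi0 he hn hn' hGab, by rw [← he, hGab], ⟨-n * M, ?_⟩, hGa.symm⟩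
    rw [ha']; push_cast; ring

/-- The intersection points of the ascending sheet with the others have distinct heights. -/
lemma index_eq_of_height_eq {i j : ℕ} (hi : 0 < i) (hiM : i < M) (hj : 0 < j) (hjM : j < M)
    {a b : ℝ} (ha : a ∈ Icc (-l) r) (hb : b ∈ Icc (-l) r) (hGa : G a = G (a + i * k))
    (hGb : G b = G (b + j * k)) (hab : G a = G b) : i = j := by
  have hab' : a = b := H.strictMonoOn.injOn ha hb hab
  subst hab'
  have hk := H.one_le_k
  have hl := H.l_mem
  have hr := H.r_mem
  have key : ∀ i j : ℕ, 0 < i → i < j → j < M → G (a + j * k) < G (a + i * k) := by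
    intro i j hi hij hjM
    have h1 := cast_mul_add_le k hi
    simp only [Nat.cast_zero, zero_mul, zero_add] at h1
    have h2 := cast_mul_add_le k hij
    have h3 := cast_mul_add_le k hjM
    exact H.lt_of_add_one_le _ _ (by linarith [ha.1, hl.2, hr.2]) (by linarith)
      (by linarith [ha.2, hl.2, hr.2])
  by_contra hne
  rcases lt_or_gt_of_ne hne with h | h
  · have := key i j hi h hjM; linarith
  · have := key j i hj h hiM; linarith

end IsSheetProfile

/-! ### Geographic coordinates on the two-sphere -/

/-- The point of the sphere with azimuth `2 π x.1 / k` and latitude `x.2`. The azimuth is scaled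
so that it has period `k` in the first coordinate. -/
def sphereCoord (k : ℕ) (x : ℝ × ℝ) : S2 :=
  ⟨!₂[Real.cos x.2 * Real.cos (2 * Real.pi * x.1 / k),
      Real.cos x.2 * Real.sin (2 * Real.pi * x.1 / k), Real.sin x.2], by
    rw [mem_sphere_zero_iff_norm, EuclideanSpace.norm_eq, Real.sqrt_eq_one]
    simp only [Fin.sum_univ_three, Real.norm_eq_abs, sq_abs]
    simp only [Matrix.cons_val_zero, Matrix.cons_val_one, Matrix.cons_val]
    have h1 := Real.sin_sq_add_cos_sq x.2
    have h2 := Real.sin_sq_add_cos_sq (2 * Real.pi * x.1 / k)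
    linear_combination h1 + Real.cos x.2 ^ 2 * h2⟩

lemma continuous_sphereCoord (k : ℕ) : Continuous (sphereCoord k) := by
  refine Continuous.subtype_mk ?_ _
  refine (PiLp.continuous_toLp 2 _).comp (continuous_pi fun i => ?_)
  fin_cases i <;> simp <;> fun_prop

lemma sphereCoord_eq_iff {k : ℕ} {u z u' z' : ℝ} :
    sphereCoord k (u, z) = sphereCoord k (u', z') ↔
      Real.cos z * Real.cos (2 * Real.pi * u / k) = Real.cos z' * Real.cos (2 * Real.pi * u' / k) ∧
      Real.cos z * Real.sin (2 * Real.pi * u / k) = Real.cos z' * Real.sin (2 * Real.pi * u' / k) ∧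
      Real.sin z = Real.sin z' := by
  constructor
  · intro h
    have h' := congrArg (fun s : S2 => (s : EuclideanSpace ℝ (Fin 3))) h
    have h0 := congrArg (fun s : EuclideanSpace ℝ (Fin 3) => s 0) h'
    have h1 := congrArg (fun s : EuclideanSpace ℝ (Fin 3) => s 1) h'
    have h2 := congrArg (fun s : EuclideanSpace ℝ (Fin 3) => s 2) h'
    simp [sphereCoord] at h0 h1 h2
    exact ⟨h0, h1, h2⟩
  · rintro ⟨h0, h1, h2⟩
    apply Subtype.ext
    simp only [sphereCoord, h0, h1, h2]

lemma sphereCoord_add_int_mul {k : ℕ} (hk : 0 < k) (u z : ℝ) (n : ℤ) :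
    sphereCoord k (u + n * k, z) = sphereCoord k (u, z) := by
  have e : 2 * Real.pi * (u + n * k) / k = 2 * Real.pi * u / k + n * (2 * Real.pi) := by
    have : (k : ℝ) ≠ 0 := by positivity
    field_simp
  rw [sphereCoord_eq_iff, e, Real.cos_add_int_mul_two_pi, Real.sin_add_int_mul_two_pi]
  simp

lemma eq_of_sphereCoord_eq {k : ℕ} {u z u' z' : ℝ}
    (hz : z ∈ Icc (-(Real.pi / 2)) (Real.pi / 2)) (hz' : z' ∈ Icc (-(Real.pi / 2)) (Real.pi / 2))
    (h : sphereCoord k (u, z) = sphereCoord k (u', z')) : z = z' :=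
  Real.injOn_sin hz hz' (sphereCoord_eq_iff.1 h).2.2

lemma exists_int_of_sphereCoord_eq {k : ℕ} (hk : 0 < k) {u z u' : ℝ}
    (hz : z ∈ Ioo (-(Real.pi / 2)) (Real.pi / 2))
    (h : sphereCoord k (u, z) = sphereCoord k (u', z)) : ∃ n : ℤ, u = u' + n * k := by
  obtain ⟨h0, h1, -⟩ := sphereCoord_eq_iff.1 h
  have hc := (Real.cos_pos_of_mem_Ioo hz).ne'
  have ha := Real.Angle.cos_sin_inj (mul_left_cancel₀ hc h0) (mul_left_cancel₀ hc h1)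
  obtain ⟨n, hn⟩ := Real.Angle.angle_eq_iff_two_pi_dvd_sub.1 ha
  refine ⟨n, ?_⟩
  have hk' : (k : ℝ) ≠ 0 := by positivity
  have hpi := Real.pi_ne_zero
  field_simp at hn
  linarith

lemma exists_sphereCoord_eq {k : ℕ} (hk : 0 < k) (P : S2) :
    ∃ u ∈ Icc (-(k : ℝ)) k, ∃ z ∈ Icc (-(Real.pi / 2)) (Real.pi / 2),
      sphereCoord k (u, z) = P := by
  obtain ⟨P, hP⟩ := P
  have hP' : P 0 ^ 2 + P 1 ^ 2 + P 2 ^ 2 = 1 := by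
    rw [mem_sphere_zero_iff_norm, EuclideanSpace.norm_eq, Real.sqrt_eq_one] at hP
    simpa [Fin.sum_univ_three] using hP
  set c : ℂ := ⟨P 0, P 1⟩ with hc
  have hk' : (0 : ℝ) < k := by exact_mod_cast hk
  have hpi := Real.pi_pos
  have hu : 2 * Real.pi * (k * c.arg / (2 * Real.pi)) / k = c.arg := by field_simp
  have hcos : Real.cos (Real.arcsin (P 2)) = ‖c‖ := by
    rw [Real.cos_arcsin, Complex.norm_def, Complex.normSq_apply]
    congr 1
    simp only [hc]
    linarith
  refine ⟨k * c.arg / (2 * Real.pi), ⟨?_, ?_⟩, Real.arcsin (P 2),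
    Real.arcsin_mem_Icc _, Subtype.ext ?_⟩
  · rw [le_div_iff₀ (by positivity)]
    nlinarith [Complex.neg_pi_lt_arg c]
  · rw [div_le_iff₀ (by positivity)]
    nlinarith [Complex.arg_le_pi c]
  · simp only [sphereCoord, hu, hcos]
    have h2 : Real.sin (Real.arcsin (P 2)) = P 2 :=
      Real.sin_arcsin (by nlinarith [sq_nonneg (P 0), sq_nonneg (P 1)])
        (by nlinarith [sq_nonneg (P 0), sq_nonneg (P 1)])
    ext i
    fin_cases i
    · exact Complex.norm_mul_cos_arg c
    · exact Complex.norm_mul_sin_arg c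
    · exact h2

/-- Openness in the sphere can be tested in geographic coordinates, since these map a compact
rectangle onto the sphere. -/
lemma isOpen_of_sphereCoord {k : ℕ} (hk : 0 < k) {A : Set S2} {W : Set (ℝ × ℝ)} (hW : IsOpen W)
    (hAW : ∀ u, ∀ z ∈ Icc (-(Real.pi / 2)) (Real.pi / 2), sphereCoord k (u, z) ∈ A ↔ (u, z) ∈ W) :
    IsOpen A := by
  let K : Set (ℝ × ℝ) := Icc (-(k : ℝ)) k ×ˢ Icc (-(Real.pi / 2)) (Real.pi / 2)
  have : CompactSpace K := isCompact_iff_compactSpace.1 (isCompact_Icc.prod isCompact_Icc)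
  let f : K → S2 := fun x => sphereCoord k x.1
  have hf : Continuous f := (continuous_sphereCoord k).comp continuous_subtype_val
  have hsurj : Function.Surjective f := by
    intro P
    obtain ⟨u, hu, z, hz, h⟩ := exists_sphereCoord_eq hk P
    exact ⟨⟨(u, z), hu, hz⟩, h⟩
  rw [← (hf.isClosedMap.isQuotientMap hf hsurj).isOpen_preimage]
  have : f ⁻¹' A = Subtype.val ⁻¹' W := by
    ext ⟨⟨u, z⟩, hu, hz⟩
    exact hAW u z hz
  rw [this]
  exact hW.preimage continuous_subtype_val

/-! ### The complement of the curve of a sheet profile -/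

/-- The number of sheets above a point. -/
def sheetRank (k M : ℕ) (G : ℝ → ℝ) (x : ℝ × ℝ) : ℕ :=
  ((Finset.range M).filter fun j : ℕ => x.2 < G (x.1 + j * k)).card

/-- The points off the sheets, in geographic coordinates, which lie below exactly `i` sheets. -/
def sheetLevel (k M : ℕ) (G : ℝ → ℝ) (i : ℕ) : Set (ℝ × ℝ) :=
  {x | (∀ n : ℤ, G (x.1 + n * k) ≠ x.2) ∧ sheetRank k M G x = i}

/-- Where no sheet from the `i`-th on is above one of the first `i` sheets, the sheets above a
point of level `i` are exactly the first `i` ones. -/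
lemma forall_of_mem_sheetLevel {k M : ℕ} {G : ℝ → ℝ} {i : ℕ} {x : ℝ × ℝ}
    (hx : x ∈ sheetLevel k M G i)
    (hsep : ∀ j < i, ∀ j' < M, i ≤ j' → G (x.1 + j' * k) ≤ G (x.1 + j * k)) :
    (∀ j < i, x.2 < G (x.1 + j * k)) ∧ ∀ j < M, i ≤ j → G (x.1 + j * k) < x.2 := by
  obtain ⟨hne, hrank⟩ := hx
  set J := (Finset.range M).filter (fun j : ℕ => x.2 < G (x.1 + j * k)) with hJ
  have hmem : ∀ j, j ∈ J ↔ j < M ∧ x.2 < G (x.1 + j * k) := by simp [hJ]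
  have hsub : J ⊆ Finset.range i := by
    intro j' hj'
    rw [Finset.mem_range]
    by_contra hij
    have h1 : insert j' (Finset.range i) ⊆ J := by
      intro j hj
      rcases Finset.mem_insert.1 hj with rfl | hj
      · exact hj'
      · rw [Finset.mem_range] at hj
        rw [hmem] at hj' ⊢
        exact ⟨by omega, hj'.2.trans_le (hsep j hj j' hj'.1 (by omega))⟩
    have h2 := Finset.card_le_card h1
    rw [Finset.card_insert_of_notMem (by simpa using hij), Finset.card_range] at h2
    change J.card = i at hrank
    omega
  have hJi : J = Finset.range i :=
    Finset.eq_of_subset_of_card_le hsub (by rw [Finset.card_range]; exact hrank.ge)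
  have hmem' : ∀ j, j < i ↔ j < M ∧ x.2 < G (x.1 + j * k) := fun j => by
    rw [← hmem, hJi, Finset.mem_range]
  refine ⟨fun j hj => ((hmem' j).1 hj).2, fun j hj hij => ?_⟩
  refine lt_of_le_of_ne (le_of_not_gt fun h => ?_) (by simpa using hne j)
  exact absurd ((hmem' j).2 ⟨hj, h⟩) (by omega)

/-- The closed curve on the sphere whose latitude is given by `G`. -/
def sphereCurve (k : ℕ) (G : ℝ → ℝ) (u : ℝ) : S2 := sphereCoord k (u, G u)

namespace IsSheetProfile

variable {k M : ℕ} {l r : ℝ} {G : ℝ → ℝ} (H : IsSheetProfile k M l r G)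
include H

lemma mem_Icc (u : ℝ) : G u ∈ Icc (-(Real.pi / 2)) (Real.pi / 2) :=
  Ioo_subset_Icc_self (H.mem_Ioo u)

lemma exists_sheet (n : ℤ) : ∃ j < M, ∀ u, G (u + n * k) = G (u + j * k) := by
  have hM : (0 : ℤ) < M := by exact_mod_cast H.M_pos
  obtain ⟨j, hj⟩ := Int.eq_ofNat_of_zero_le (Int.emod_nonneg n hM.ne')
  refine ⟨j, ?_, fun u => ?_⟩
  · have := Int.emod_lt_of_pos n hM
    omega
  · rw [← H.periodic_int (u + j * k) (n / M)]
    congr 1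
    have : (n : ℝ) = j + M * (n / M : ℤ) := by
      have := Int.emod_add_mul_ediv n M
      rw [hj] at this
      exact_mod_cast this.symm
    rw [this]; ring

lemma sheetRank_add (x : ℝ × ℝ) (n : ℤ) :
    sheetRank k M G (x.1 + n * k, x.2) = sheetRank k M G x := by
  have hper : Function.Periodic (fun u => sheetRank k M G (u, x.2)) (k : ℝ) := by
    intro u
    have hp : Function.Periodic (fun j : ℕ => x.2 < G (u + j * k)) M := by
      intro j
      simp only
      rw [← H.periodic (u + j * k)]
      rw [show u + j * k + M * k = u + (j + M : ℕ) * k by push_cast; ring]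
    have h1 := Nat.filter_Ico_card_eq_of_periodic 1 M _ hp
    have h0 := Nat.filter_Ico_card_eq_of_periodic 0 M _ hp
    simp only [sheetRank]
    rw [zero_add, ← Finset.range_eq_Ico] at h0
    rw [h0, ← h1, Finset.range_eq_Ico]
    refine Finset.card_bij (fun j _ => j + 1) ?_ ?_ ?_
    · intro j hj
      simp only [Finset.mem_filter, Finset.mem_Ico] at hj ⊢
      refine ⟨by omega, ?_⟩
      convert hj.2 using 2
      push_cast; ring
    · intro a _ b _ h
      omega
    · intro j hj
      simp only [Finset.mem_filter, Finset.mem_Ico] at hj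
      refine ⟨j - 1, ?_, by omega⟩
      simp only [Finset.mem_filter, Finset.mem_Ico]
      refine ⟨by omega, ?_⟩
      convert hj.2 using 2
      rw [Nat.cast_sub hj.1.1]
      push_cast; ring
  exact hper.int_mul n x.1

/-- Whether a point lies in a given level depends only on its image in the sphere. -/
lemma mem_sheetLevel_of_eq {i : ℕ} {u z u' z' : ℝ}
    (hz : z ∈ Icc (-(Real.pi / 2)) (Real.pi / 2)) (hz' : z' ∈ Icc (-(Real.pi / 2)) (Real.pi / 2))
    (h : sphereCoord k (u, z) = sphereCoord k (u', z')) (hx : (u', z') ∈ sheetLevel k M G i) :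
    (u, z) ∈ sheetLevel k M G i := by
  obtain rfl := eq_of_sphereCoord_eq hz hz' h
  rcases hz.1.eq_or_lt with h1 | h1
  · refine ⟨fun n => by rw [← h1]; exact (H.mem_Ioo _).1.ne', ?_⟩
    rw [← hx.2]
    simp only [sheetRank, ← h1, (H.mem_Ioo _).1]
  rcases hz.2.eq_or_lt with h2 | h2
  · refine ⟨fun n => by rw [h2]; exact (H.mem_Ioo _).2.ne, ?_⟩
    rw [← hx.2]
    simp only [sheetRank, h2, (H.mem_Ioo _).2.not_gt]
  obtain ⟨n, rfl⟩ := exists_int_of_sphereCoord_eq H.k_pos ⟨h1, h2⟩ h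
  refine ⟨fun m => ?_, ?_⟩
  · have := hx.1 (n + m)
    push_cast at this
    rwa [add_mul, ← add_assoc] at this
  · rw [← hx.2]
    exact H.sheetRank_add (u', z) n

lemma isOpen_sheetLevel (i : ℕ) : IsOpen (sheetLevel k M G i) := by
  rw [isOpen_iff_mem_nhds]
  rintro x ⟨hx, hxi⟩
  have hcont : ∀ j : ℕ, Continuous fun y : ℝ × ℝ => G (y.1 + j * k) := fun j =>
    H.continuous.comp (by fun_prop)
  have h : ∀ᶠ y in nhds x, ∀ j ∈ Finset.range M,
      G (y.1 + j * k) ≠ y.2 ∧ (y.2 < G (y.1 + j * k) ↔ x.2 < G (x.1 + j * k)) := by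
    rw [Filter.eventually_all_finset]
    intro j _
    have hj := hx j
    rw [Int.cast_natCast] at hj
    rcases lt_or_gt_of_ne hj with h | h
    · filter_upwards [(hcont j).continuousAt.eventually_lt continuous_snd.continuousAt h] with y hy
      exact ⟨hy.ne, iff_of_false hy.not_gt h.not_gt⟩
    · filter_upwards [continuous_snd.continuousAt.eventually_lt (hcont j).continuousAt h] with y hy
      exact ⟨hy.ne', iff_of_true hy h⟩
  filter_upwards [h] with y hy
  refine ⟨fun n => ?_, ?_⟩
  · obtain ⟨j, hj, hn⟩ := H.exists_sheet n
    rw [hn]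
    exact (hy j (Finset.mem_range.2 hj)).1
  · rw [← hxi, sheetRank, sheetRank]
    exact congrArg _ (Finset.filter_congr fun j hj => (hy j hj).2)

/-- The image of a level in the sphere. -/
lemma sphereCoord_mem_image_iff {i : ℕ} {u z : ℝ} (hz : z ∈ Icc (-(Real.pi / 2)) (Real.pi / 2)) :
    sphereCoord k (u, z) ∈
        sphereCoord k '' {x ∈ sheetLevel k M G i | x.2 ∈ Icc (-(Real.pi / 2)) (Real.pi / 2)} ↔
      (u, z) ∈ sheetLevel k M G i := by
  constructor
  · rintro ⟨⟨u', z'⟩, ⟨hx, hz'⟩, h⟩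
    exact H.mem_sheetLevel_of_eq hz hz' h.symm hx
  · exact fun h => ⟨(u, z), ⟨h, hz⟩, rfl⟩

lemma mem_compl_range_iff {u z : ℝ} (hz : z ∈ Icc (-(Real.pi / 2)) (Real.pi / 2)) :
    sphereCoord k (u, z) ∈ (range (sphereCurve k G))ᶜ ↔ ∀ n : ℤ, G (u + n * k) ≠ z := by
  rw [mem_compl_iff, not_iff_comm]
  push Not
  constructor
  · rintro ⟨n, rfl⟩
    exact ⟨u + n * k, sphereCoord_add_int_mul H.k_pos _ _ _⟩
  · rintro ⟨a, ha⟩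
    obtain rfl := eq_of_sphereCoord_eq (H.mem_Icc a) hz ha
    obtain ⟨n, hn⟩ := exists_int_of_sphereCoord_eq H.k_pos (H.mem_Ioo a) ha
    exact ⟨n, by rw [← hn]⟩

/-- A point which lies below the first `i` sheets and above the others is in level `i`. -/
lemma mem_sheetLevel {i : ℕ} (hi : i ≤ M) {x : ℝ × ℝ}
    (h1 : ∀ j < i, x.2 < G (x.1 + j * k)) (h2 : ∀ j < M, i ≤ j → G (x.1 + j * k) < x.2) :
    x ∈ sheetLevel k M G i := by
  refine ⟨fun n => ?_, ?_⟩
  · obtain ⟨j, hj, hn⟩ := H.exists_sheet n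
    rw [hn]
    rcases lt_or_ge j i with h | h
    · exact (h1 j h).ne'
    · exact (h2 j hj h).ne
  · have : (Finset.range M).filter (fun j : ℕ => x.2 < G (x.1 + j * k)) = Finset.range i := by
      ext j
      simp only [Finset.mem_filter, Finset.mem_range]
      refine ⟨fun h => lt_of_not_ge fun hij => (h2 j h.1 hij).not_gt h.2, fun h => ?_⟩
      exact ⟨h.trans_le hi, h1 j h⟩
    rw [sheetRank, this, Finset.card_range]

/-- The points over a connected set of azimuths which lie below the first `i` sheets and above the
others are connected and nonempty as soon as the former sheets are above the latter. -/
lemma isPreconnected_region {i : ℕ} (hi : i ≤ M) {I : Set ℝ} (hI : IsPreconnected I)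
    (hne : I.Nonempty)
    (hsep : ∀ u ∈ I, ∀ j < i, ∀ j' < M, i ≤ j' → G (u + j' * k) < G (u + j * k)) :
    let R := {x : ℝ × ℝ | x.1 ∈ I ∧ x.2 ∈ Icc (-(Real.pi / 2)) (Real.pi / 2) ∧
      (∀ j < i, x.2 < G (x.1 + j * k)) ∧ ∀ j < M, i ≤ j → G (x.1 + j * k) < x.2}
    IsPreconnected R ∧ R.Nonempty := by
  intro R
  obtain ⟨u₀, hu₀⟩ := hne
  have hc : ∀ j : ℕ, Continuous fun u : ℝ => G (u + j * k) := fun j =>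
    H.continuous.comp (by fun_prop)
  rcases Nat.eq_zero_or_pos i with rfl | hi0
  · -- The cap around the north pole.
    have hs : (Finset.range M).Nonempty := Finset.nonempty_range_iff.2 H.M_pos.ne'
    have hR : R = {x : ℝ × ℝ | x.1 ∈ I ∧ ∃ s ∈ Ioc (0 : ℝ) 1,
        x.2 = (Finset.range M).sup' hs (fun j : ℕ => G (x.1 + j * k)) +
          s * (Real.pi / 2 - (Finset.range M).sup' hs (fun j : ℕ => G (x.1 + j * k)))} := by
      ext ⟨u, z⟩
      simp only [R, mem_ofPred_eq]
      set a := (Finset.range M).sup' hs (fun j : ℕ => G (u + j * k)) with ha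
      have ha1 : a < Real.pi / 2 := (Finset.sup'_lt_iff hs).2 fun j _ => (H.mem_Ioo _).2
      have ha0 : -(Real.pi / 2) < a :=
        (Finset.lt_sup'_iff hs).2 ⟨0, Finset.mem_range.2 H.M_pos, (H.mem_Ioo _).1⟩
      have ha2 : (∀ j < M, 0 ≤ j → G (u + j * k) < z) ↔ a < z := by
        rw [ha, Finset.sup'_lt_iff hs]; simp
      rw [ha2]
      refine and_congr_right fun _ => ⟨fun h => ?_, ?_⟩
      · have h0 : 0 < Real.pi / 2 - a := by linarith
        refine ⟨(z - a) / (Real.pi / 2 - a), ⟨div_pos (by linarith [h.2.2]) h0, ?_⟩, ?_⟩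
        · rw [div_le_one h0]; linarith [h.1.2]
        · rw [div_mul_cancel₀ _ h0.ne']; ring
      · rintro ⟨s, hs, rfl⟩
        have h0 : 0 < Real.pi / 2 - a := by linarith
        have h1 := mul_pos hs.1 h0
        have h2 : s * (Real.pi / 2 - a) ≤ 1 * (Real.pi / 2 - a) := by gcongr; exact hs.2
        exact ⟨⟨by linarith, by linarith⟩, by simp, by linarith⟩
    constructor
    · rw [hR]
      exact isPreconnected_between hI isPreconnected_Ioc
        (Continuous.finset_sup'_apply hs fun j _ => hc j) continuous_const
    · refine ⟨(u₀, Real.pi / 2), hu₀, ⟨by linarith [Real.pi_pos], le_rfl⟩, by simp, ?_⟩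
      exact fun j _ _ => (H.mem_Ioo _).2
  have hs1 : (Finset.range i).Nonempty := Finset.nonempty_range_iff.2 hi0.ne'
  have hlow : ∀ u z : ℝ, (∀ j < i, z < G (u + j * k)) ↔
      z < (Finset.range i).inf' hs1 (fun j : ℕ => G (u + j * k)) := by
    intro u z
    rw [Finset.lt_inf'_iff hs1]; simp
  have hc1 := Continuous.finset_inf'_apply hs1 fun j _ => hc j
  have hb1 : ∀ u, (Finset.range i).inf' hs1 (fun j : ℕ => G (u + j * k)) ∈
      Ioo (-(Real.pi / 2)) (Real.pi / 2) := fun u =>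
    ⟨(Finset.lt_inf'_iff hs1).2 fun j _ => (H.mem_Ioo _).1,
      (Finset.inf'_lt_iff hs1).2 ⟨0, Finset.mem_range.2 hi0, (H.mem_Ioo _).2⟩⟩
  rcases hi.eq_or_lt with rfl | hiM
  · -- The cap around the south pole.
    have hR : R = {x : ℝ × ℝ | x.1 ∈ I ∧ ∃ s ∈ Ioc (0 : ℝ) 1,
        x.2 = (Finset.range i).inf' hs1 (fun j : ℕ => G (x.1 + j * k)) +
          s * (-(Real.pi / 2) - (Finset.range i).inf' hs1 (fun j : ℕ => G (x.1 + j * k)))} := by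
      ext ⟨u, z⟩
      simp only [R, mem_ofPred_eq, hlow]
      have hb := hb1 u
      set a := (Finset.range i).inf' hs1 (fun j : ℕ => G (u + j * k)) with ha
      have h0 : 0 < Real.pi / 2 + a := by linarith [hb.1]
      refine and_congr_right fun _ => ⟨fun h => ?_, ?_⟩
      · refine ⟨(a - z) / (Real.pi / 2 + a), ⟨div_pos (by linarith [h.2.1]) h0, ?_⟩, ?_⟩
        · rw [div_le_one h0]; linarith [h.1.1]
        · rw [show -(Real.pi / 2) - a = -(Real.pi / 2 + a) by ring, mul_neg,
            div_mul_cancel₀ _ h0.ne']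
          ring
      · rintro ⟨s, hs, rfl⟩
        have h1 := mul_pos hs.1 h0
        have h2 : s * (Real.pi / 2 + a) ≤ 1 * (Real.pi / 2 + a) := by gcongr; exact hs.2
        refine ⟨⟨by linarith, by linarith [hb.2]⟩, by linarith, fun j h h' => ?_⟩
        exact absurd h' (by omega)
    constructor
    · rw [hR]
      exact isPreconnected_between hI isPreconnected_Ioc hc1 continuous_const
    · refine ⟨(u₀, -(Real.pi / 2)), hu₀, ⟨le_rfl, by linarith [Real.pi_pos]⟩,
        fun j _ => (H.mem_Ioo _).1, fun j h h' => absurd h' (by omega)⟩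
  -- A region between two sheets.
  have hs2 : (Finset.Ico i M).Nonempty := Finset.nonempty_Ico.2 hiM
  have hupp : ∀ u z : ℝ, (∀ j < M, i ≤ j → G (u + j * k) < z) ↔
      (Finset.Ico i M).sup' hs2 (fun j : ℕ => G (u + j * k)) < z := by
    intro u z
    rw [Finset.sup'_lt_iff hs2]
    simp only [Finset.mem_Ico]
    exact ⟨fun h j hj => h j hj.2 hj.1, fun h j h1 h2 => h j ⟨h2, h1⟩⟩
  have hc2 := Continuous.finset_sup'_apply hs2 fun j _ => hc j
  have hb2 : ∀ u, -(Real.pi / 2) < (Finset.Ico i M).sup' hs2 (fun j : ℕ => G (u + j * k)) :=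
    fun u => (Finset.lt_sup'_iff hs2).2 ⟨i, Finset.mem_Ico.2 ⟨le_rfl, hiM⟩, (H.mem_Ioo _).1⟩
  have hab : ∀ u ∈ I, (Finset.Ico i M).sup' hs2 (fun j : ℕ => G (u + j * k)) <
      (Finset.range i).inf' hs1 (fun j : ℕ => G (u + j * k)) := by
    intro u hu
    rw [← hlow]
    intro j hj
    rw [← hupp]
    exact fun j' hj' hij' => hsep u hu j hj j' hj' hij'
  have hR : R = {x : ℝ × ℝ | x.1 ∈ I ∧ ∃ s ∈ Ioo (0 : ℝ) 1,
      x.2 = (Finset.Ico i M).sup' hs2 (fun j : ℕ => G (x.1 + j * k)) +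
        s * ((Finset.range i).inf' hs1 (fun j : ℕ => G (x.1 + j * k)) -
          (Finset.Ico i M).sup' hs2 (fun j : ℕ => G (x.1 + j * k)))} := by
    ext ⟨u, z⟩
    simp only [R, mem_ofPred_eq, hlow, hupp]
    refine and_congr_right fun hu => ?_
    have hb := hb1 u
    have hb' := hb2 u
    have h0 := sub_pos.2 (hab u hu)
    set a := (Finset.Ico i M).sup' hs2 (fun j : ℕ => G (u + j * k))
    set b := (Finset.range i).inf' hs1 (fun j : ℕ => G (u + j * k))
    constructor
    · rintro ⟨-, h1, h2⟩
      refine ⟨(z - a) / (b - a), ⟨div_pos (by linarith) h0, ?_⟩, ?_⟩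
      · rw [div_lt_one h0]; linarith
      · field_simp; ring
    · rintro ⟨s, hs, rfl⟩
      have h1 := mul_pos hs.1 h0
      have h2 : s * (b - a) < 1 * (b - a) := by gcongr; exact hs.2
      exact ⟨⟨by linarith, by linarith [hb.2]⟩, by linarith, by linarith⟩
  rw [hR]
  refine ⟨isPreconnected_between hI isPreconnected_Ioo hc2 hc1, ⟨(u₀, ?_), hu₀, 1 / 2, ?_, ?_⟩⟩
  · exact (Finset.Ico i M).sup' hs2 (fun j : ℕ => G (u₀ + j * k)) +
      1 / 2 * ((Finset.range i).inf' hs1 (fun j : ℕ => G (u₀ + j * k)) -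
        (Finset.Ico i M).sup' hs2 (fun j : ℕ => G (u₀ + j * k)))
  · norm_num
  · rfl

lemma image_sheetLevel_isPreconnected_nonempty {i : ℕ} (hi : i ≤ M) :
    let A := sphereCoord k '' {x ∈ sheetLevel k M G i |
      x.2 ∈ Icc (-(Real.pi / 2)) (Real.pi / 2)}
    IsPreconnected A ∧ A.Nonempty := by
  intro A
  -- It suffices to find a set `I` of azimuths as follows.
  suffices h : ∃ I : Set ℝ, IsPreconnected I ∧ I.Nonempty ∧
      (∀ u ∈ I, ∀ j < i, ∀ j' < M, i ≤ j' → G (u + j' * k) < G (u + j * k)) ∧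
      ∀ u z, (u, z) ∈ sheetLevel k M G i → ∃ n : ℤ, u + n * k ∈ I ∧
        ((u + n * k, z) ∈ sheetLevel k M G i) by
    obtain ⟨I, hI, hne, hsep, htrans⟩ := h
    obtain ⟨hR, hRne⟩ := H.isPreconnected_region hi hI hne hsep
    set R := {x : ℝ × ℝ | x.1 ∈ I ∧ x.2 ∈ Icc (-(Real.pi / 2)) (Real.pi / 2) ∧
      (∀ j < i, x.2 < G (x.1 + j * k)) ∧ ∀ j < M, i ≤ j → G (x.1 + j * k) < x.2}
    have hA : A = sphereCoord k '' R := by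
      apply Subset.antisymm
      · rintro _ ⟨⟨u, z⟩, ⟨hx, hz⟩, rfl⟩
        obtain ⟨n, hn, hn'⟩ := htrans u z hx
        refine ⟨(u + n * k, z), ⟨hn, hz, ?_⟩, sphereCoord_add_int_mul H.k_pos _ _ _⟩
        exact forall_of_mem_sheetLevel hn' fun j hj j' hj' hij =>
          (hsep _ hn j hj j' hj' hij).le
      · exact image_mono fun x hx => ⟨H.mem_sheetLevel hi hx.2.2.1 hx.2.2.2, hx.2.1⟩
    rw [hA]
    exact ⟨hR.image _ (continuous_sphereCoord k).continuousOn, hRne.image _⟩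
  rcases Nat.eq_zero_or_pos i with rfl | hi0
  · exact ⟨univ, isPreconnected_univ, univ_nonempty, by simp,
      fun u z h => ⟨0, mem_univ _, by simpa using h⟩⟩
  rcases hi.eq_or_lt with rfl | hiM
  · exact ⟨univ, isPreconnected_univ, univ_nonempty, fun u _ j _ j' h h' => absurd h' (by omega),
      fun u z h => ⟨0, mem_univ _, by simpa using h⟩⟩
  obtain ⟨w, hw, hGw⟩ := H.exists_eq hi0 hiM
  have hk : (0 : ℝ) < k := by exact_mod_cast H.k_pos
  have hsep : ∀ u ∈ Ioo w (w + k), ∀ j < i, ∀ j' < M, i ≤ j' → G (u + j' * k) < G (u + j * k) :=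
    fun u hu j hj j' hj' hij => H.sheet_lt_sheet hj hij hj' hw hGw hu
  refine ⟨Ioo w (w + k), isPreconnected_Ioo, nonempty_Ioo.2 (by linarith), hsep, ?_⟩
  intro u z hx
  obtain ⟨n, hn, -⟩ := existsUnique_add_zsmul_mem_Ico hk u w
  rw [zsmul_eq_mul] at hn
  have hx' : (u + n * k, z) ∈ sheetLevel k M G i := by
    refine ⟨fun m => ?_, (H.sheetRank_add (u, z) n).trans hx.2⟩
    have := hx.1 (n + m)
    push_cast at this
    rwa [add_mul, ← add_assoc] at this
  refine ⟨n, ⟨lt_of_le_of_ne hn.1 fun hwn => ?_, hn.2⟩, hx'⟩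
  -- Over the intersection point itself there is no room between the sheets.
  rw [← hwn] at hx'
  obtain ⟨h1, h2⟩ := forall_of_mem_sheetLevel hx' fun j hj j' hj' hij => by
    have hcl : w ∈ closure (Ioo w (w + k)) := by
      rw [closure_Ioo (by linarith)]
      exact ⟨le_rfl, by linarith⟩
    have hc : ∀ j : ℕ, Continuous fun u : ℝ => G (u + j * k) := fun j =>
      H.continuous.comp (by fun_prop)
    exact le_on_closure (fun u hu => (hsep u hu j hj j' hj' hij).le) (hc j').continuousOn
      (hc j).continuousOn hcl
  have h3 := h1 0 hi0
  have h4 := h2 i hiM le_rfl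
  simp only [Nat.cast_zero, zero_mul, add_zero] at h3 h4
  linarith

/-- The complement of the curve has one component for each possible number of sheets above it. -/
lemma card_connectedComponents :
    Nat.card (ConnectedComponents ↥(range (sphereCurve k G))ᶜ) = M + 1 := by
  refine card_connectedComponents_of_partition (n := M + 1)
    (fun i => sphereCoord k '' {x ∈ sheetLevel k M G i |
      x.2 ∈ Icc (-(Real.pi / 2)) (Real.pi / 2)}) (fun i => ?_) (fun i => ?_) (fun i => ?_) ?_ ?_
  · exact isOpen_of_sphereCoord H.k_pos (H.isOpen_sheetLevel i)
      fun u z hz => H.sphereCoord_mem_image_iff hz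
  · exact (H.image_sheetLevel_isPreconnected_nonempty (Nat.lt_succ_iff.1 i.2)).1
  · exact (H.image_sheetLevel_isPreconnected_nonempty (Nat.lt_succ_iff.1 i.2)).2
  · intro i j P hi hj
    obtain ⟨u, -, z, hz, rfl⟩ := exists_sphereCoord_eq H.k_pos P
    rw [H.sphereCoord_mem_image_iff hz] at hi hj
    exact Fin.ext (hi.2.symm.trans hj.2)
  · intro P
    obtain ⟨u, -, z, hz, rfl⟩ := exists_sphereCoord_eq H.k_pos P
    simp only [H.sphereCoord_mem_image_iff hz]
    rw [H.mem_compl_range_iff hz]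
    refine ⟨fun h => ⟨⟨sheetRank k M G (u, z), Nat.lt_succ_of_le ?_⟩, h, rfl⟩, ?_⟩
    · exact (Finset.card_filter_le _ _).trans (Finset.card_range M).le
    · rintro ⟨i, h, -⟩
      exact h

/-- The curve has one double point for each sheet which the ascending sheet has to pass. -/
lemma nonempty_doublePoints_equiv :
    Nonempty ({c : S2 // ∃ a b : ℝ, (¬ ∃ n : ℤ, b = a + n * (M * k)) ∧
      sphereCurve k G a = c ∧ sphereCurve k G b = c} ≃ Fin (M - 1)) := by
  have hex : ∀ i : Fin (M - 1), ∃ w ∈ Ioo (-l) r, G w = G (w + (i.1 + 1 : ℕ) * k) := fun i =>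
    H.exists_eq (Nat.succ_pos _) (by omega)
  choose w hw hGw using hex
  have hk : (0 : ℝ) < k := by exact_mod_cast H.k_pos
  let f : Fin (M - 1) → {c : S2 // ∃ a b : ℝ, (¬ ∃ n : ℤ, b = a + n * (M * k)) ∧
      sphereCurve k G a = c ∧ sphereCurve k G b = c} := fun i =>
    ⟨sphereCurve k G (w i), w i, w i + (i.1 + 1 : ℕ) * k, by
      rintro ⟨n, hn⟩
      rw [add_right_inj, ← mul_assoc] at hn
      have hn' := mul_right_cancel₀ hk.ne' hn
      have hn'' : ((i.1 + 1 : ℕ) : ℤ) = n * M := by exact_mod_cast hn'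
      have := Int.le_of_dvd (by positivity) (Dvd.intro_left n hn''.symm)
      omega, rfl, by
      have := sphereCoord_add_int_mul H.k_pos (w i) (G (w i)) (i.1 + 1 : ℕ)
      rw [Int.cast_natCast] at this
      simp only [sphereCurve]
      rw [← hGw, this]⟩
  have hf : Function.Bijective f := by
    constructor
    · intro i j hij
      have h := congrArg Subtype.val hij
      have h' := eq_of_sphereCoord_eq (H.mem_Icc _) (H.mem_Icc _) h
      have := H.index_eq_of_height_eq (Nat.succ_pos _) (by omega) (Nat.succ_pos _) (by omega)
        (Ioo_subset_Icc_self (hw i)) (Ioo_subset_Icc_self (hw j)) (hGw i) (hGw j) h'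
      exact Fin.ext (by omega)
    · rintro ⟨c, a, b, hab, rfl, hb⟩
      have hG : G b = G a := eq_of_sphereCoord_eq (H.mem_Icc _) (H.mem_Icc _) hb
      rw [sphereCurve, sphereCurve, hG] at hb
      obtain ⟨m, hm⟩ := exists_int_of_sphereCoord_eq H.k_pos (H.mem_Ioo a) hb
      have hmM : ¬ (M : ℤ) ∣ m := by
        rintro ⟨n, rfl⟩
        exact hab ⟨n, by rw [hm]; push_cast; ring⟩
      obtain ⟨i, hi0, hiM, w', hw', hGw', ⟨n, hn⟩, hGa⟩ := H.exists_of_eq hm hmM hG.symm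
      refine ⟨⟨i - 1, by omega⟩, Subtype.ext ?_⟩
      have hi : (⟨i - 1, by omega⟩ : Fin (M - 1)).1 + 1 = i := by simp only; omega
      have h2 := hGw ⟨i - 1, by omega⟩
      rw [hi] at h2
      have h3 := H.eq_of_eq hi0 hiM (Ioo_subset_Icc_self (hw _)) hw' h2 hGw'
      simp only [f, sphereCurve]
      rw [h3, hn, ← hn, hGa, hn, sphereCoord_add_int_mul H.k_pos]
  exact ⟨(Equiv.ofBijective f hf).symm⟩

end IsSheetProfile

/-! ### The Lagrangian projection of a special front -/

/-- The latitude in the Lagrangian projection of a Legendrian curve whose front has slope `σ`: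
its sine is the height `1 - 2 r₁²`. -/
def latitude (σ : ℝ) : ℝ := Real.arcsin ((1 + σ) / (1 - σ))

lemma one_add_div_one_sub {σ : ℝ} (hσ : σ < 0) : (1 + σ) / (1 - σ) = 2 / (1 - σ) - 1 := by
  have : 1 - σ ≠ 0 := by linarith
  field_simp
  ring

lemma one_add_div_one_sub_mem {σ : ℝ} (hσ : σ < 0) : (1 + σ) / (1 - σ) ∈ Ioo (-1 : ℝ) 1 := by
  have h1 : 0 < 1 - σ := by linarith
  constructor
  · rw [lt_div_iff₀ h1]; linarith
  · rw [div_lt_one h1]; linarith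

lemma latitude_mem_Ioo {σ : ℝ} (hσ : σ < 0) :
    latitude σ ∈ Ioo (-(Real.pi / 2)) (Real.pi / 2) :=
  ⟨Real.neg_pi_div_two_lt_arcsin.2 (one_add_div_one_sub_mem hσ).1,
    Real.arcsin_lt_pi_div_two.2 (one_add_div_one_sub_mem hσ).2⟩

lemma strictMonoOn_latitude : StrictMonoOn latitude (Iio 0) := by
  intro a ha b hb hab
  rw [mem_Iio] at ha hb
  refine Real.strictMonoOn_arcsin (Ioo_subset_Icc_self (one_add_div_one_sub_mem ha))
    (Ioo_subset_Icc_self (one_add_div_one_sub_mem hb)) ?_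
  rw [one_add_div_one_sub ha, one_add_div_one_sub hb]
  have : 2 / (1 - a) < 2 / (1 - b) :=
    div_lt_div_of_pos_left two_pos (by linarith) (by linarith)
  linarith

lemma continuousOn_latitude : ContinuousOn latitude (Iio 0) := by
  refine Real.continuous_arcsin.comp_continuousOn (ContinuousOn.div (by fun_prop) (by fun_prop) ?_)
  intro σ hσ
  rw [mem_Iio] at hσ
  linarith

lemma sin_latitude {σ : ℝ} (hσ : σ < 0) :
    Real.sin (latitude σ) = 1 - 2 * legendrianRadius σ ^ 2 := by
  have h := one_add_div_one_sub_mem hσ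
  have h1 : 0 < 1 - σ := by linarith
  rw [latitude, Real.sin_arcsin h.1.le h.2.le, legendrianRadius,
    Real.sq_sqrt (div_nonneg (by linarith) h1.le)]
  field_simp
  ring

lemma cos_latitude {σ : ℝ} (hσ : σ < 0) :
    Real.cos (latitude σ) = 2 * legendrianRadius σ * Real.sqrt (1 - legendrianRadius σ ^ 2) := by
  obtain ⟨h0, h1, -⟩ := legendrianRadius_spec hσ
  have h2 := Real.sin_sq_add_cos_sq (latitude σ)
  rw [sin_latitude hσ] at h2
  have h3 : 0 ≤ 1 - legendrianRadius σ ^ 2 := by nlinarith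
  have h4 := (Real.cos_pos_of_mem_Ioo (latitude_mem_Ioo hσ)).le
  rw [← sq_eq_sq₀ h4 (by positivity), mul_pow, Real.sq_sqrt h3]
  linear_combination h2

lemma horizontalPart_polarPoint (m : ℕ) {r : ℝ} (h0 : 0 < r) (h1 : r < 1) (a b : ℝ) :
    horizontalPart m (polarPoint r a b h0.le h1.le) =
      ((2 * r * Real.sqrt (1 - r ^ 2) : ℝ) : ℂ) * Complex.exp ((m * (a - b) : ℝ) * Complex.I) := by
  have h2 : 0 < Real.sqrt (1 - r ^ 2) := Real.sqrt_pos.2 (by nlinarith)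
  have hph : phase (polarPoint r a b h0.le h1.le) = Complex.exp ((a - b : ℝ) * Complex.I) := by
    simp only [phase, polarPoint, norm_mul, norm_exp_real_mul_I, mul_one, Complex.norm_real,
      Real.norm_eq_abs, abs_of_pos h0, abs_of_pos h2, map_mul, ← Complex.exp_conj,
      Complex.conj_ofReal, Complex.conj_I]
    rw [div_eq_iff (by exact_mod_cast (mul_pos h0 h2).ne')]
    have : Complex.exp (((a - b : ℝ) : ℂ) * Complex.I)
        = Complex.exp (a * Complex.I) * Complex.exp (b * -Complex.I) := by
      rw [← Complex.exp_add]; congr 1; push_cast; ring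
    rw [this]
    push_cast
    ring
  rw [horizontalPart, hph, ← Complex.exp_nat_mul]
  simp only [polarPoint, norm_mul, norm_exp_real_mul_I, mul_one, Complex.norm_real,
    Real.norm_eq_abs, abs_of_pos h0, abs_of_pos h2]
  congr 2
  push_cast
  ring

namespace SpecialFront

variable {h v : ℕ} (S : SpecialFront h v)

/-- The coordinate `x - y` along the front; up to scale it is the azimuth of the Lagrangian
projection. -/
def diag (t : ℝ) : ℝ := S.x t - S.y t

lemma differentiable_x : Differentiable ℝ S.x := S.contDiff_x.differentiable (by simp)

lemma differentiable_y : Differentiable ℝ S.y := S.contDiff_y.differentiable (by simp)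

lemma continuous_diag : Continuous S.diag :=
  S.differentiable_x.continuous.sub S.differentiable_y.continuous

lemma strictMono_diag : StrictMono S.diag := by
  refine strictMono_of_deriv_pos fun t => ?_
  have : deriv S.diag t = deriv S.x t - deriv S.y t :=
    deriv_sub (S.differentiable_x t) (S.differentiable_y t)
  rw [this]
  linarith [S.deriv_x_pos t, S.deriv_y_neg t]

lemma diag_add (t : ℝ) : S.diag (t + (h + v)) = S.diag t + (h + v) := by
  rw [diag, S.x_periodic, S.y_periodic, diag]; ring

lemma diag_add_int_mul (t : ℝ) (n : ℤ) : S.diag (t + n * (h + v)) = S.diag t + n * (h + v) := by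
  have hp : Function.Periodic (fun t => S.diag t - t) ((h : ℝ) + v) := fun t => by
    simp only [S.diag_add]; ring
  have := hp.int_mul n t
  linarith

lemma surjective_diag (hN : 0 < h + v) : Function.Surjective S.diag := by
  have hN' : (0 : ℝ) < h + v := by exact_mod_cast hN
  intro c
  obtain ⟨n, hn⟩ := exists_int_gt ((c - S.diag 0) / (h + v))
  obtain ⟨m, hm⟩ := exists_int_lt ((c - S.diag 0) / (h + v))
  rw [div_lt_iff₀ hN'] at hn
  rw [lt_div_iff₀ hN'] at hm
  refine mem_range_of_exists_le_of_exists_ge S.continuous_diag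
    ⟨0 + m * (h + v), ?_⟩ ⟨0 + n * (h + v), ?_⟩
  · rw [S.diag_add_int_mul]; linarith
  · rw [S.diag_add_int_mul]; linarith

lemma boxCol_sub_boxRow (h v : ℕ) (i : ℤ) : boxCol h v i - boxRow h v i = i := by
  have h1 := Int.emod_add_mul_ediv i (h + v)
  have h2 : min (i % (h + v)) (h : ℤ) + max (i % (h + v) - h) 0 = i % (h + v) := by omega
  rw [boxCol, boxRow]
  linear_combination h1 + h2

/-- Sliding a basepoint in the direction `(1, 1)` does not change `x - y`. -/
lemma basepoint_fst_sub_snd (h v : ℕ) (s : ℤ → ℝ) (i : ℤ) :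
    (basepoint h v s i).1 - (basepoint h v s i).2 = i := by
  have : ((boxCol h v i - boxRow h v i : ℤ) : ℝ) = i := by rw [boxCol_sub_boxRow]
  push_cast at this
  simp only [basepoint]
  linarith

lemma coord_eq_of_mem_segment {i : ℤ} {t : ℝ}
    (ht : t ∈ Icc (i + S.right i) (i + 1 - S.left (i + 1))) :
    S.x t = (t - i) * ((basepoint h v S.slide (i + 1)).1 - (basepoint h v S.slide i).1) +
        (basepoint h v S.slide i).1 ∧
      S.y t = (t - i) * ((basepoint h v S.slide (i + 1)).2 - (basepoint h v S.slide i).2) +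
        (basepoint h v S.slide i).2 := by
  have := S.eq_segment i t ht
  rw [AffineMap.lineMap_apply] at this
  exact ⟨congrArg Prod.fst this, congrArg Prod.snd this⟩

lemma diag_eq_of_mem_segment {i : ℤ} {t : ℝ}
    (ht : t ∈ Icc (i + S.right i) (i + 1 - S.left (i + 1))) : S.diag t = t := by
  obtain ⟨hx, hy⟩ := S.coord_eq_of_mem_segment ht
  have h0 := basepoint_fst_sub_snd h v S.slide i
  have h1 := basepoint_fst_sub_snd h v S.slide (i + 1)
  push_cast at h1
  rw [diag, hx, hy]
  linear_combination (t - i) * h1 + (1 - (t - i)) * h0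

lemma continuous_slope : Continuous S.slope :=
  (S.contDiff_y.continuous_deriv (by simp)).div (S.contDiff_x.continuous_deriv (by simp))
    fun t => (S.deriv_x_pos t).ne'

lemma add_right_lt_sub_left (i : ℤ) : (i : ℝ) + S.right i < i + 1 - S.left (i + 1) := by
  linarith [(S.right_mem i).2, (S.left_mem (i + 1)).2]

lemma slope_eq_of_mem_segment {i : ℤ} {t : ℝ}
    (ht : t ∈ Icc (i + S.right i) (i + 1 - S.left (i + 1))) :
    S.slope t = segmentSlope h v S.slide i := by
  have hopen : EqOn S.slope (fun _ => segmentSlope h v S.slide i)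
      (Ioo (i + S.right i) (i + 1 - S.left (i + 1))) := by
    intro t ht
    have hev : ∀ᶠ s in nhds t, s ∈ Icc (i + S.right i) (i + 1 - S.left (i + 1)) :=
      Filter.mem_of_superset (Ioo_mem_nhds ht.1 ht.2) Ioo_subset_Icc_self
    have hlin : ∀ a b : ℝ, deriv (fun s : ℝ => (s - i) * a + b) t = a := fun a b => by
      have : HasDerivAt (fun s : ℝ => (s - i) * a + b) (1 * a) t :=
        (((hasDerivAt_id t).sub_const (i : ℝ)).mul_const a).add_const b
      rw [this.deriv, one_mul]
    have hx := Filter.EventuallyEq.deriv_eq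
      (hev.mono fun s hs => (S.coord_eq_of_mem_segment hs).1)
    have hy := Filter.EventuallyEq.deriv_eq
      (hev.mono fun s hs => (S.coord_eq_of_mem_segment hs).2)
    rw [hlin] at hx hy
    simp only [slope, hx, hy, segmentSlope]
  have := hopen.closure S.continuous_slope continuous_const
  rw [closure_Ioo (S.add_right_lt_sub_left i).ne] at this
  exact this ht

/-- The front reparametrized by `x - y`: the parameter at which `x - y` takes a given value. -/
def param (hN : 0 < h + v) : ℝ ≃o ℝ :=
  (S.strictMono_diag.orderIsoOfSurjective S.diag (S.surjective_diag hN)).symm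

lemma diag_param (hN : 0 < h + v) (u : ℝ) : S.diag (S.param hN u) = u :=
  (S.strictMono_diag.orderIsoOfSurjective S.diag (S.surjective_diag hN)).apply_symm_apply u

lemma param_diag (hN : 0 < h + v) (t : ℝ) : S.param hN (S.diag t) = t :=
  (S.strictMono_diag.orderIsoOfSurjective S.diag (S.surjective_diag hN)).symm_apply_apply t

lemma param_eq_of_mem_segment (hN : 0 < h + v) {i : ℤ} {t : ℝ}
    (ht : t ∈ Icc (i + S.right i) (i + 1 - S.left (i + 1))) : S.param hN t = t := by
  conv_lhs => rw [← S.diag_eq_of_mem_segment ht]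
  exact S.param_diag hN t

lemma param_mapsTo (hN : 0 < h + v) (i : ℤ) :
    MapsTo (S.param hN) (Icc (i - S.left i) (i + S.right i))
      (Icc (i - S.left i) (i + S.right i)) := by
  have h1 := S.param_eq_of_mem_segment hN (left_mem_Icc.2 (S.add_right_lt_sub_left i).le)
  have h2 := S.param_eq_of_mem_segment hN (right_mem_Icc.2 (S.add_right_lt_sub_left (i - 1)).le)
  rw [sub_add_cancel, Int.cast_sub, Int.cast_one, sub_add_cancel] at h2
  intro u hu
  rw [← h1, ← h2]
  exact ⟨(S.param hN).monotone hu.1, (S.param hN).monotone hu.2⟩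

/-- The latitude of the Lagrangian projection as a function of `x - y`. -/
def profile (hN : 0 < h + v) (u : ℝ) : ℝ := latitude (S.slope (S.param hN u))

lemma profile_strictAntiOn (hN : 0 < h + v) {i : ℤ} (hi : ¬ ((h + v : ℤ) ∣ i)) :
    StrictAntiOn (S.profile hN) (Icc (i - S.left i) (i + S.right i)) := fun _ ha _ hb hab =>
  strictMonoOn_latitude (S.slope_neg _) (S.slope_neg _) <|
    S.slope_strictAntiOn i hi (S.param_mapsTo hN i ha) (S.param_mapsTo hN i hb)
      ((S.param hN).strictMono hab)

lemma profile_strictMonoOn (hN : 0 < h + v) {i : ℤ} (hi : (h + v : ℤ) ∣ i) :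
    StrictMonoOn (S.profile hN) (Icc (i - S.left i) (i + S.right i)) := fun _ ha _ hb hab =>
  strictMonoOn_latitude (S.slope_neg _) (S.slope_neg _) <|
    S.slope_strictMonoOn i hi (S.param_mapsTo hN i ha) (S.param_mapsTo hN i hb)
      ((S.param hN).strictMono hab)

lemma profile_eq_of_mem_segment (hN : 0 < h + v) {i : ℤ} {t : ℝ}
    (ht : t ∈ Icc (i + S.right i) (i + 1 - S.left (i + 1))) :
    S.profile hN t = latitude (segmentSlope h v S.slide i) := by
  rw [profile, S.param_eq_of_mem_segment hN ht, S.slope_eq_of_mem_segment ht]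

lemma profile_antitoneOn (hN : 0 < h + v) (n : ℕ) (hn : n < h + v) :
    AntitoneOn (S.profile hN) (Icc (S.right 0) (n + 1 - S.left (n + 1))) := by
  have hseg : ∀ i : ℤ, AntitoneOn (S.profile hN) (Icc (i + S.right i) (i + 1 - S.left (i + 1))) :=
    fun i a ha b hb _ => by
      rw [S.profile_eq_of_mem_segment hN ha, S.profile_eq_of_mem_segment hN hb]
  induction n with
  | zero => simpa using hseg 0
  | succ n ih =>
    have h1 := ih (by omega)
    have h2 := (S.profile_strictAntiOn hN (i := (n + 1 : ℕ)) fun hd => by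
      have := Int.le_of_dvd (by positivity) hd
      omega).antitoneOn
    have h3 := hseg (n + 1 : ℕ)
    have hs := S.add_right_lt_sub_left (n + 1 : ℕ)
    have hl := S.left_mem (n + 1 : ℕ)
    have hl' := S.left_mem ((n + 1 : ℕ) + 1)
    have hr := S.right_mem (n + 1 : ℕ)
    have hr0 := S.right_mem 0
    push_cast at *
    have hn0 : (0 : ℝ) ≤ n := n.cast_nonneg
    have h12 := h1.union_right h2
      (isGreatest_Icc (by linarith [hl.2, hr0.2])) (isLeast_Icc (by linarith [hl.1, hr.1]))
    rw [Icc_union_Icc_eq_Icc (by linarith [hl.2, hr0.2]) (by linarith [hl.1, hr.1])] at h12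
    have h123 := h12.union_right h3
      (isGreatest_Icc (by linarith [hr.1, hr0.2])) (isLeast_Icc hs.le)
    rwa [Icc_union_Icc_eq_Icc (by linarith [hr.1, hr0.2]) hs.le] at h123

/-- The latitude is a sheet profile: it increases in Box `0` only. -/
lemma isSheetProfile (hN : 0 < h + v) {k M : ℕ} (hkM : h + v = M * k) :
    IsSheetProfile k M (S.left 0) (S.right 0) (S.profile hN) := by
  have hkM' : (M : ℝ) * k = h + v := by exact_mod_cast hkM.symm
  have hpos : 0 < M * k := hkM ▸ hN
  have hleft : S.left (((h + v - 1 : ℕ) : ℤ) + 1) = S.left 0 := by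
    rw [← S.left_periodic 0]; congr 1; omega
  have hcast : ((h + v - 1 : ℕ) : ℝ) + 1 = h + v := by
    exact_mod_cast Nat.sub_add_cancel hN
  have hanti : AntitoneOn (S.profile hN) (Icc (S.right 0) (M * k - S.left 0)) := by
    have := S.profile_antitoneOn hN (h + v - 1) (by omega)
    rwa [hleft, hcast, ← hkM'] at this
  refine ⟨Nat.pos_of_mul_pos_left hpos, Nat.pos_of_mul_pos_right hpos, S.left_mem 0, S.right_mem 0,
    ?_, fun u => ?_, fun u => latitude_mem_Ioo (S.slope_neg _), ?_, hanti, ?_⟩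
  · exact continuousOn_latitude.comp_continuous
      (S.continuous_slope.comp (S.param hN).continuous) fun u => S.slope_neg _
  · have : S.param hN (u + M * k) = S.param hN u + (h + v) := by
      apply S.strictMono_diag.injective
      rw [S.diag_add, S.diag_param, S.diag_param, hkM']
    rw [profile, this, S.slope_periodic, profile]
  · simpa using S.profile_strictMonoOn hN (i := 0) (dvd_zero _)
  · intro a b ha hab hb
    -- The interval `[a, b)` contains an integer, in whose box the slope strictly decreases.
    have hr0 := S.right_mem 0
    have hl0 := S.left_mem 0
    have hi1 := Int.le_ceil a
    have hi2 := Int.ceil_lt_add_one a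
    set i := ⌈a⌉
    have hi0 : 0 < i := by
      have : (0 : ℝ) < i := by linarith [hr0.1]
      exact_mod_cast this
    have hiN : i < h + v := by
      have : (i : ℝ) < h + v := by linarith [hl0.1]
      exact_mod_cast this
    have hl := S.left_mem i
    have hr := S.right_mem i
    have hc1 : (i : ℝ) < min b (i + S.right i) := lt_min (by linarith) (by linarith [hr.1])
    have h1 := S.profile_strictAntiOn hN (i := i)
      (fun hd => by have := Int.le_of_dvd hi0 hd; omega)
      (a := i) (b := min b (i + S.right i)) ⟨by linarith [hl.1], by linarith [hr.1]⟩
      ⟨by linarith [hl.1], min_le_right _ _⟩ hc1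
    have h2 := hanti (a := a) (b := i) ⟨ha, by linarith⟩ ⟨by linarith, by linarith⟩ hi1
    have hc2 := min_le_left b (i + S.right i)
    have h3 := hanti (a := min b (i + S.right i)) (b := b) ⟨by linarith, by linarith⟩
      ⟨by linarith, by linarith⟩ hc2
    linarith

lemma lagCurve_eq (p q : ℕ) (hp : 0 < p) (hq : 1 < q) (hN : 0 < h + v) (t : ℝ) :
    S.lagCurve p q hp hq t = sphereCurve (Nat.gcd (q - 1) p) (S.profile hN) (S.diag t) := by
  obtain ⟨h0, h1, -⟩ := legendrianRadius_spec (S.slope_neg t)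
  show sphereProj (p / Nat.gcd (q - 1) p) (S.lift p t) = _
  have hk : 0 < Nat.gcd (q - 1) p := Nat.gcd_pos_of_pos_right _ hp
  obtain ⟨m, hm⟩ := Nat.gcd_dvd_right (q - 1) p
  rw [sphereCurve, profile, S.param_diag]
  generalize Nat.gcd (q - 1) p = k at *
  have hmk : p / k = m := Nat.div_eq_of_eq_mul_right hk hm
  have hm0 : (m : ℝ) ≠ 0 := by
    rintro h
    rw [Nat.cast_eq_zero] at h
    subst h
    omega
  have hk0 : (k : ℝ) ≠ 0 := by positivity
  have hang : (m : ℝ) * (2 * Real.pi * S.x t / p - 2 * Real.pi * S.y t / p) =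
      2 * Real.pi * S.diag t / k := by
    have : (p : ℝ) = k * m := by exact_mod_cast hm
    rw [this, diag]
    field_simp
  have hhor := horizontalPart_polarPoint m h0 h1 (2 * Real.pi * S.x t / p) (2 * Real.pi * S.y t / p)
  rw [hang, ← cos_latitude (S.slope_neg t)] at hhor
  change horizontalPart m (S.lift p t) = _ at hhor
  have hsq : 0 ≤ 1 - legendrianRadius (S.slope t) ^ 2 := by nlinarith
  have hheight : ‖(S.lift p t).1.2‖ ^ 2 - ‖(S.lift p t).1.1‖ ^ 2 =
      Real.sin (latitude (S.slope t)) := by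
    rw [sin_latitude (S.slope_neg t)]
    simp only [lift, polarPoint, norm_mul, norm_exp_real_mul_I, mul_one, Complex.norm_real,
      Real.norm_eq_abs, sq_abs]
    rw [Real.sq_sqrt hsq]
    ring
  apply Subtype.ext
  simp only [sphereProj, sphereCoord]
  rw [hmk, hheight, hhor, Complex.re_ofReal_mul, Complex.im_ofReal_mul, Complex.exp_ofReal_mul_I_re,
    Complex.exp_ofReal_mul_I_im]

lemma Gamma_eq (p q : ℕ) (hp : 0 < p) (hq : 1 < q) (hN : 0 < h + v) :
    S.Gamma p q hp hq = range (sphereCurve (Nat.gcd (q - 1) p) (S.profile hN)) := by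
  rw [Gamma, show S.lagCurve p q hp hq =
    sphereCurve (Nat.gcd (q - 1) p) (S.profile hN) ∘ S.diag from
      funext (S.lagCurve_eq p q hp hq hN), (S.surjective_diag hN).range_comp]

lemma crossings_eq (p q : ℕ) (hp : 0 < p) (hq : 1 < q) (hN : 0 < h + v)
    (hclose : p ∣ h + v * q) :
    S.crossings p q hp hq = {c | ∃ a b : ℝ, (¬ ∃ n : ℤ, b = a + n * (h + v)) ∧
      sphereCurve (Nat.gcd (q - 1) p) (S.profile hN) a = c ∧
      sphereCurve (Nat.gcd (q - 1) p) (S.profile hN) b = c} := by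
  have hN' : (0 : ℝ) < h + v := by exact_mod_cast hN
  have hper : Function.Periodic (S.lagCurve p q hp hq) ((h : ℝ) + v) := fun t => by
    rw [lagCurve, S.knot_periodic p q hp hclose, lagCurve]
  ext c
  constructor
  · rintro ⟨s, hs, t, ht, hst, hsc, htc⟩
    rw [S.lagCurve_eq p q hp hq hN] at hsc htc
    refine ⟨S.diag s, S.diag t, ?_, hsc, htc⟩
    rintro ⟨n, hn⟩
    rw [← S.diag_add_int_mul] at hn
    have hn' := S.strictMono_diag.injective hn
    have h1 : (n : ℝ) * (h + v) < 1 * (h + v) := by linarith [hs.1, ht.2]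
    have h2 : (-1) * ((h : ℝ) + v) < n * (h + v) := by linarith [hs.2, ht.1]
    have h1' := lt_of_mul_lt_mul_right h1 hN'.le
    have h2' := lt_of_mul_lt_mul_right h2 hN'.le
    have h3 : n < 1 := by exact_mod_cast h1'
    have h4 : -1 < n := by exact_mod_cast h2'
    obtain rfl : n = 0 := by omega
    apply hst
    rw [hn']
    simp
  · rintro ⟨a, b, hab, ha, hb⟩
    obtain ⟨s, rfl⟩ := S.surjective_diag hN a
    obtain ⟨t, rfl⟩ := S.surjective_diag hN b
    rw [← S.lagCurve_eq p q hp hq hN] at ha hb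
    obtain ⟨n, hn, -⟩ := existsUnique_add_zsmul_mem_Ico hN' s 0
    obtain ⟨m, hm, -⟩ := existsUnique_add_zsmul_mem_Ico hN' t 0
    rw [zsmul_eq_mul, zero_add] at hn hm
    refine ⟨_, hn, _, hm, fun h => hab ⟨n - m, ?_⟩, ?_, ?_⟩
    · rw [← S.diag_add_int_mul]
      congr 1
      push_cast
      linarith
    · rw [hper.int_mul n s, ha]
    · rw [hper.int_mul m t, hb]

end SpecialFront

/-- Multiples of `k` in `(0, h)` and in `(0, v]` together count the multiples of `k` in
`(0, h + v)`: reflect the second kind by `y ↦ h + v - y`. -/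
lemma nonempty_fin_equiv_multiples {h v k M : ℕ} (hh : 0 < h) (hkM : h + v = M * k) :
    Nonempty (Fin (M - 1) ≃ {x : ℕ // 0 < x ∧ x < h ∧ k ∣ x} ⊕ {y : ℕ // 0 < y ∧ y ≤ v ∧ k ∣ y}) := by
  have hk : 0 < k := Nat.pos_of_ne_zero fun h => by subst h; omega
  let Z := {z : ℕ // 0 < z ∧ z < h + v ∧ k ∣ z}
  let f : Fin (M - 1) → Z := fun i => ⟨(i.1 + 1) * k, by positivity, by
    rw [hkM]; exact Nat.mul_lt_mul_of_pos_right (by omega) hk, Dvd.intro_left _ rfl⟩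
  have hf : Function.Bijective f := by
    constructor
    · intro i j hij
      have := Nat.eq_of_mul_eq_mul_right hk (congrArg Subtype.val hij)
      exact Fin.ext (by omega)
    · rintro ⟨z, hz0, hz, c, rfl⟩
      have hc0 : 0 < c := Nat.pos_of_mul_pos_left hz0
      have hcM : c < M := by
        rw [hkM, mul_comm k c] at hz
        exact lt_of_mul_lt_mul_right hz hk.le
      refine ⟨⟨c - 1, by omega⟩, Subtype.ext ?_⟩
      show (c - 1 + 1) * k = k * c
      rw [Nat.sub_add_cancel hc0, mul_comm]
  let g : {x : ℕ // 0 < x ∧ x < h ∧ k ∣ x} ⊕ {y : ℕ // 0 < y ∧ y ≤ v ∧ k ∣ y} → Z :=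
    Sum.elim (fun x => ⟨x.1, x.2.1, by have := x.2.2.1; omega, x.2.2.2⟩)
      (fun y => ⟨h + v - y.1, by have := y.2.2.1; omega, by have := y.2.1; omega,
        Nat.dvd_sub (hkM ▸ Dvd.intro_left _ rfl) y.2.2.2⟩)
  have hg : Function.Bijective g := by
    constructor
    · rintro (⟨x, hx⟩ | ⟨x, hx⟩) (⟨y, hy⟩ | ⟨y, hy⟩) hxy <;>
        have hxy' := congrArg Subtype.val hxy <;> simp only [g, Sum.elim_inl, Sum.elim_inr] at hxy'
      · subst hxy'; rfl
      · omega
      · omega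
      · obtain rfl : x = y := by omega
        rfl
    · rintro ⟨z, hz0, hz, hkz⟩
      by_cases hzh : z < h
      · exact ⟨Sum.inl ⟨z, hz0, hzh, hkz⟩, rfl⟩
      · refine ⟨Sum.inr ⟨h + v - z, by omega, by omega,
          Nat.dvd_sub (hkM ▸ Dvd.intro_left _ rfl) hkz⟩, Subtype.ext ?_⟩
        show h + v - (h + v - z) = z
        omega
  exact ⟨(Equiv.ofBijective f hf).trans (Equiv.ofBijective g hg).symm⟩

end

theorem theorem3p2 (p q h v : ℕ) (hp : 0 < p) (hq : 1 < q) (hqp : q < p)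
    (hcop : Nat.Coprime q p) (hh : 0 < h) (hhp : h < p) (hprim : Nat.Coprime h p)
    (hv : 0 < v) (hvp : v < p) (hclose : p ∣ h + v * q) (S : SpecialFront h v) :
    Nonempty (S.crossings p q hp hq ≃
      {x : ℕ // 0 < x ∧ x < h ∧ Nat.gcd (q - 1) p ∣ x} ⊕
        {y : ℕ // 0 < y ∧ y ≤ v ∧ Nat.gcd (q - 1) p ∣ y}) ∧
    Nat.card (ConnectedComponents ↥(S.Gamma p q hp hq)ᶜ) =
      Nat.card (S.crossings p q hp hq) + 2 := by
  have hN : 0 < h + v := by omega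
  -- The front closes up, and `q` is congruent to `1` modulo `k`, so `k` divides the period.
  have hdvd : Nat.gcd (q - 1) p ∣ h + v := by
    have h1 : Nat.gcd (q - 1) p ∣ h + v * q := (Nat.gcd_dvd_right _ _).trans hclose
    have h2 : Nat.gcd (q - 1) p ∣ v * (q - 1) := (Nat.gcd_dvd_left _ _).mul_left v
    have h3 : h + v * q = h + v + v * (q - 1) := by
      obtain ⟨q', rfl⟩ : ∃ q', q = q' + 1 := ⟨q - 1, by omega⟩
      rw [Nat.add_sub_cancel]; ring
    rw [h3] at h1
    exact (Nat.dvd_add_left h2).1 h1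
  obtain ⟨M, hM⟩ := hdvd
  rw [mul_comm] at hM
  have H := S.isSheetProfile hN hM
  have hM' : (M : ℝ) * (Nat.gcd (q - 1) p : ℕ) = h + v := by exact_mod_cast hM.symm
  obtain ⟨e⟩ := H.nonempty_doublePoints_equiv
  obtain ⟨e'⟩ := nonempty_fin_equiv_multiples hh hM
  have hcross := S.crossings_eq p q hp hq hN hclose
  rw [← hM'] at hcross
  have e₀ : S.crossings p q hp hq ≃ Fin (M - 1) := (Equiv.setCongr hcross).trans e
  refine ⟨⟨e₀.trans e'⟩, ?_⟩
  rw [Nat.card_congr e₀, Nat.card_fin, S.Gamma_eq p q hp hq hN, H.card_connectedComponents]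
  have := H.M_pos
  omega
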